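/- Let $d\ge 1$ and $1<p<1+4/d$. **Continuum.** For $v\in H^1(\mathbb{R}^d;\mathbb{C})$ put $M(v)=\int_{\mathbb{R}^d}|v|^2\,dx$ and $H(v)=\frac12\int_{\mathbb{R}^d}|\nabla v|^2\,dx-\frac1{p+1}\int_{\mathbb{R}^d}|v|^{p+1}\,dx$, and let $E_{\min}(m)=\inf\{H(v): v\in H^1(\mathbb{R}^d;\mathbb{C}),\ M(v)=m\}$. **Lattice.** For $h>0$ and square-summable $v:\mathbb{Z}^d\to\mathbb{C}$ put $M_h(v)=h^d\sum_{x\in\mathbb{Z}^d}|v(x)|^2$ and $$H_h(v)=\frac{h^d}{2}\sum_{x\sim y}\Bigl|\frac{v(x)-v(y)}{h}\Bigr|^2-\frac{h^d}{p+1}\sum_{x\in\mathbb{Z}^d}|v(x)|^{p+1},$$ where the first sum is over the nearest-neighbour edges of $\mathbb{Z}^d$, each counted once. Let $E_{\min}(m,h)$ and $E_{\max}(m,h)$ be the infimum and the supremum of $H_h(v)$ over all $v$ with $M_h(v)=m$. **Variational problem.** Let $\Psi_d:\mathbb{R}\to[0,\infty]$ be given by $$\Psi_d(\alpha)=\sup_{0<\gamma<1}\int_{[0,1]^d}\log\Bigl(1-\gamma+\frac{4\gamma}{\alpha}\sum_{i=1}^d\sin^2(\pi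 x_i)\Bigr)dx\qquad(0<\alpha<2d),$$ $\Psi_d(2d)=0$, $\Psi_d(\alpha)=\Psi_d(4d-\alpha)$ for $2d<\alpha<4d$, and $\Psi_d(\alpha)=\infty$ for $\alpha\le 0$ and for $\alpha\ge 4d$. For $E,m\ge 0$ and $h>0$ let $\Theta(E,m,h)=\log m-\Psi_d(2h^2E/m)$ if $m>0$, and $\Theta(E,0,h)=-\infty$. For $m_0>0$, $E_0\in\mathbb{R}$ and $h>0$ let $$\mathcal{R}(E_0,m_0,h)=\bigl\{(E,m): 0\le m\le m_0,\ \max\{E_0-E_{\max}(m_0-m,h),\,0\}\le E\le E_0-E_{\min}(m_0-m,h)\bigr\},$$ and let $\mathcal{M}(E_0,m_0,h)$ be the set of all $(E,m)\in\mathcal{R}(E_0,m_0,h)$ that maximise $\Theta(\cdot,\cdot,h)$ over $\mathcal{R}(E_0,m_0,h)$. **Theorem.** Fix $m_0>0$ and $E_0\in\mathbb{R}$ with $E_0>E_{\min}(m_0)$. For all sufficiently small $h>0$ let $(E_h,m_h)$ be an element of $\mathcal{M}(E_0,m_0,h)$. Then $$\lim_{h\downarrow0}m_h=0\qquad\text{and}\qquad\lim_{h\downarrow0}E_h=E_0-E_{\min}(m_0).$$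 -/

import Mathlib

open Filter Topology MeasureTheory
open scoped ContDiff

noncomputable section

namespace NLS

/-! ### Mass and energy on `ℝ^d` -/

/-- `g i` is the weak partial derivative of `v` in direction `i`, for every `i`: for all real test
functions `φ ∈ C_c^∞(ℝ^d)`, `∫ ∂_i φ v = - ∫ φ g_i`. -/
def IsWeakGradient {d : ℕ} (v : EuclideanSpace ℝ (Fin d) → ℂ)
    (g : Fin d → EuclideanSpace ℝ (Fin d) → ℂ) : Prop :=
  ∀ (φ : EuclideanSpace ℝ (Fin d) → ℝ), ContDiff ℝ ∞ φ → HasCompactSupport φ →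
    ∀ i : Fin d,
      ∫ x, (fderiv ℝ φ x (EuclideanSpace.single i 1)) • v x = - ∫ x, φ x • g i x

/-- `v ∈ H¹(ℝ^d)` with weak gradient `g`. -/
structure IsH1 {d : ℕ} (v : EuclideanSpace ℝ (Fin d) → ℂ)
    (g : Fin d → EuclideanSpace ℝ (Fin d) → ℂ) : Prop where
  memLp : MemLp v 2 volume
  memLp_grad : ∀ i, MemLp (g i) 2 volume
  weakGradient : IsWeakGradient v g

/-- The mass `M(v) = ∫ |v|²`. -/
def mass {d : ℕ} (v : EuclideanSpace ℝ (Fin d) → ℂ) : ℝ :=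
  ∫ x, ‖v x‖ ^ 2

/-- The energy `H(v) = (1/2) ∫ |∇v|² - (1/(p+1)) ∫ |v|^{p+1}`, where `g = ∇v`. -/
def energy {d : ℕ} (p : ℝ) (v : EuclideanSpace ℝ (Fin d) → ℂ)
    (g : Fin d → EuclideanSpace ℝ (Fin d) → ℂ) : ℝ :=
  1 / 2 * (∫ x, ∑ i, ‖g i x‖ ^ 2) - 1 / (p + 1) * ∫ x, ‖v x‖ ^ (p + 1)

/-- The set of possible energies of `H¹` functions of mass `m`. The integrability of `|v|^{p+1}`
only says that the energy is well defined. -/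
def energySet (d : ℕ) (p m : ℝ) : Set ℝ :=
  {e | ∃ (v : EuclideanSpace ℝ (Fin d) → ℂ) (g : Fin d → EuclideanSpace ℝ (Fin d) → ℂ),
    IsH1 v g ∧ Integrable (fun x => ‖v x‖ ^ (p + 1)) ∧ mass v = m ∧ energy p v g = e}

/-- The minimum energy `E_min(m) = inf {H(v) : v ∈ H¹(ℝ^d), M(v) = m}`. -/
def Emin (d : ℕ) (p m : ℝ) : ℝ :=
  sInf (energySet d p m)

/-! ### Mass and energy on the lattice `ℤ^d` at grid size `h` -/

/-- The discrete mass `M_h(v) = h^d ∑_x |v(x)|²`. -/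
def latticeMass {d : ℕ} (h : ℝ) (v : (Fin d → ℤ) → ℂ) : ℝ :=
  h ^ d * ∑' x, ‖v x‖ ^ 2

/-- The discrete energy
`H_h(v) = (h^d/2) ∑_{x ∼ y} |(v(x)-v(y))/h|² - (h^d/(p+1)) ∑_x |v(x)|^{p+1}`.
The first sum is over the edges of the lattice `ℤ^d`, each counted once: the edges are the pairs
`{x, x + e_i}`. -/
def latticeEnergy {d : ℕ} (p h : ℝ) (v : (Fin d → ℤ) → ℂ) : ℝ :=
  h ^ d / 2 * (∑' x : Fin d → ℤ, ∑ i : Fin d, ‖(v (x + Pi.single i 1) - v x) / (h : ℂ)‖ ^ 2)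
    - h ^ d / (p + 1) * ∑' x : Fin d → ℤ, ‖v x‖ ^ (p + 1)

/-- The set of possible energies, at grid size `h`, of functions on `ℤ^d` of (finite) mass `m`. -/
def latticeEnergySet (d : ℕ) (p m h : ℝ) : Set ℝ :=
  {e | ∃ v : (Fin d → ℤ) → ℂ,
    Summable (fun x => ‖v x‖ ^ 2) ∧ latticeMass h v = m ∧ latticeEnergy p h v = e}

/-- `E_min(m,h)`. -/
def latticeEmin (d : ℕ) (p m h : ℝ) : ℝ :=
  sInf (latticeEnergySet d p m h)

/-- `E_max(m,h)`. -/
def latticeEmax (d : ℕ) (p m h : ℝ) : ℝ :=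
  sSup (latticeEnergySet d p m h)

/-! ### The functions `Ψ_d` and `Θ` and the variational problem -/

/-- `sup_{0<γ<1} ∫_{[0,1]^d} log (1 - γ + (4γ/α) ∑_i sin²(π x_i)) dx`, as an extended real. -/
def PsiAux (d : ℕ) (α : ℝ) : EReal :=
  ⨆ γ ∈ Set.Ioo (0 : ℝ) 1,
    ((∫ x in Set.Icc (0 : Fin d → ℝ) 1,
      Real.log (1 - γ + 4 * γ / α * ∑ i, Real.sin (Real.pi * x i) ^ 2) : ℝ) : EReal)

open Classical in
/-- The function `Ψ_d : ℝ → [0,∞]`. -/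
def Psi (d : ℕ) (α : ℝ) : EReal :=
  if α ≤ 0 ∨ 4 * (d : ℝ) ≤ α then ⊤
  else if α < 2 * (d : ℝ) then PsiAux d α
  else if α = 2 * (d : ℝ) then 0
  else PsiAux d (4 * (d : ℝ) - α)

open Classical in
/-- `Θ(E,m,h) = log m - Ψ_d(2h²E/m)`, with the value `-∞` at `m = 0`. -/
def Theta (d : ℕ) (E m h : ℝ) : EReal :=
  if m = 0 then ⊥ else (Real.log m : EReal) - Psi d (2 * h ^ 2 * E / m)

/-- The admissible region `R(E₀,m₀,h)` of pairs `(E,m)`: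
`0 ≤ m ≤ m₀` and `max {E₀ - E_max(m₀-m,h), 0} ≤ E ≤ E₀ - E_min(m₀-m,h)`. -/
def region (d : ℕ) (p E₀ m₀ h : ℝ) : Set (ℝ × ℝ) :=
  {q | 0 ≤ q.2 ∧ q.2 ≤ m₀ ∧
    max (E₀ - latticeEmax d p (m₀ - q.2) h) 0 ≤ q.1 ∧
    q.1 ≤ E₀ - latticeEmin d p (m₀ - q.2) h}

/-- `M(E₀,m₀,h)`: the set of all `(E,m)` maximizing `Θ(E,m,h)` over `R(E₀,m₀,h)`. -/
def maximizers (d : ℕ) (p E₀ m₀ h : ℝ) : Set (ℝ × ℝ) :=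
  {q | q ∈ region d p E₀ m₀ h ∧
    ∀ q' ∈ region d p E₀ m₀ h, Theta d q'.1 q'.2 h ≤ Theta d q.1 q.2 h}

end NLS

end

noncomputable section

namespace NLS

section

set_option linter.unusedSectionVars false

/-! ### Averages over a probability measure -/

/-! Write c = `rateConst d` = ∫ log(4 ∑ sin²(π x_i)) dx. Letting γ → 1 in the supremum gives Ψ(α) ≥
c - log α for every α > 0 (`le_Psi`), and this is sharp up to o(1) as α → 0 (`eventually_Psi_le`).
With α = 2h²E/m the mass cancels: Θ(E,m,h) ≤ log(2h²) + log E - c, with near equality when h²E/m is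
small. So maximising Θ amounts, up to o(1), to maximising E, and by the constraint E ≤ E₀ -
E_min(m₀-m,h) this favours leaving as much mass as possible to the low-energy part.

Comparison with the competitor of mass h and largest admissible energy, for which α is of order h,
gives E_h ≥ (E₀ - E_min(m₀-h,h)) e^{-ε}, whose limit is (E₀ - E_min(m₀)) e^{-ε}. Conversely E_h ≤ E₀
- E_min(m₀-m_h,h), and the lattice minimum is asymptotically at least the continuum one, uniformly
over masses below a given bound. This gives the limit of E_h. If m_h stayed above η > 0, then E_h
would be at most about E₀ - E_min(m₀-η), which is too small because E_min is strictly decreasing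
(`Emin_strictAnti`).

The analytic core is therefore E_min(m₀-h,h) → E_min(m₀) (`tendsto_latticeEmin`). Upper bound: cell
averages of a near-minimiser do not increase the Dirichlet energy and lose little mass and L^{p+1}
norm. Lower bound: averaging a lattice step function over a box of side h gives an H¹ function
(`exists_interpolant`) with no larger mass or Dirichlet energy and almost the same L^{p+1} norm.
Both that closeness and the boundedness from below rest on a lattice Gagliardo-Nirenberg inequality
uniform in h (`powInt_stepFn_le`), where p < 1 + 4/d enters. -/

theorem enorm_integral_rpow_le {T : Type*} [MeasurableSpace T] (P : Measure T)
    [IsProbabilityMeasure P] (F : T → ℂ) {q : ℝ} (hq : 1 ≤ q) :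
    ‖∫ t, F t ∂P‖ₑ ^ q ≤ ∫⁻ t, ‖F t‖ₑ ^ q ∂P := by
  have hq0 : 0 < q := by linarith
  by_cases hF : AEStronglyMeasurable F P
  · have h1 := eLpNorm_le_eLpNorm_of_exponent_le (μ := P) (f := F) (p := 1)
      (q := ENNReal.ofReal q) (by simpa using hq) hF
    rw [eLpNorm_one_eq_lintegral_enorm,
      eLpNorm_eq_lintegral_rpow_enorm_toReal (by simpa using hq0) (by simp),
      ENNReal.toReal_ofReal hq0.le] at h1
    calc ‖∫ t, F t ∂P‖ₑ ^ q ≤ (∫⁻ t, ‖F t‖ₑ ∂P) ^ q := by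
          gcongr; exact enorm_integral_le_lintegral_enorm F
      _ ≤ ((∫⁻ t, ‖F t‖ₑ ^ q ∂P) ^ (1 / q)) ^ q := by gcongr
      _ = _ := by rw [← ENNReal.rpow_mul, one_div_mul_cancel hq0.ne', ENNReal.rpow_one]
  -- The Bochner integral of a non-measurable function is 0 by convention, so no measurability
  -- hypothesis is needed.
  · rw [integral_non_aestronglyMeasurable hF]
    simp [hq0]

theorem lintegral_enorm_integral_rpow_le {X T : Type*} [MeasurableSpace X] [MeasurableSpace T]
    {μ : Measure X} [SFinite μ] (P : Measure T) [IsProbabilityMeasure P] {F : X → T → ℂ}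
    (hF : AEStronglyMeasurable (fun z : X × T => F z.1 z.2) (μ.prod P)) {q : ℝ} (hq : 1 ≤ q) :
    ∫⁻ x, ‖∫ t, F x t ∂P‖ₑ ^ q ∂μ ≤ ∫⁻ t, ∫⁻ x, ‖F x t‖ₑ ^ q ∂μ ∂P := by
  rw [← lintegral_lintegral_swap (f := fun x t => ‖F x t‖ₑ ^ q)]
  · exact lintegral_mono fun x => enorm_integral_rpow_le P _ hq
  · exact hF.enorm.pow_const q

theorem memLp_two_iff {X : Type*} [MeasurableSpace X] {μ : Measure X} {f : X → ℂ}
    (hf : AEStronglyMeasurable f μ) :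
    MemLp f 2 μ ↔ ∫⁻ x, ‖f x‖ₑ ^ (2 : ℝ) ∂μ < ⊤ := by
  rw [MemLp, eLpNorm_lt_top_iff_lintegral_rpow_enorm_lt_top (by simp) (by simp)]
  simp [hf]

/-! ### Averages of translates. -/

section Avg

variable {E : Type*} [NormedAddCommGroup E] [MeasurableSpace E] [BorelSpace E]
  [SecondCountableTopology E]

/-- The average of the translates of `f` with respect to `P`. -/
def avg (P : Measure E) (f : E → ℂ) (x : E) : ℂ := ∫ t, f (x + t) ∂P

variable (μ : Measure E) [SFinite μ] [μ.IsAddLeftInvariant] (P : Measure E)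
  [IsProbabilityMeasure P]

/-- Only the invariance of `μ` under each fixed translation is used, so `P` may be singular, such as
a measure on a segment. This keeps f(x + t) measurable for the product even when f is only a.e.
measurable. -/
theorem measurePreserving_shear :
    MeasurePreserving (fun z : E × E => (z.1 + z.2, z.2)) (μ.prod P) (μ.prod P) := by
  have h := (measurePreserving_prod_add P μ)
  have h2 := (Measure.measurePreserving_swap (μ := P) (ν := μ)).comp
    (h.comp (Measure.measurePreserving_swap (μ := μ) (ν := P)))
  convert h2 using 2 with z
  simp [add_comm]

theorem measurePreserving_add_prob :
    MeasurePreserving (fun z : E × E => z.1 + z.2) (μ.prod P) μ :=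
  measurePreserving_fst.comp (measurePreserving_shear μ P)

variable {μ} {P}

theorem aestronglyMeasurable_comp_add {f : E → ℂ} (hf : AEStronglyMeasurable f μ) :
    AEStronglyMeasurable (fun z : E × E => f (z.1 + z.2)) (μ.prod P) :=
  hf.comp_measurePreserving (measurePreserving_add_prob μ P)

theorem aestronglyMeasurable_avg {f : E → ℂ} (hf : AEStronglyMeasurable f μ) :
    AEStronglyMeasurable (avg P f) μ :=
  (aestronglyMeasurable_comp_add (P := P) hf).integral_prod_right'

theorem lintegral_avg_rpow_le {f : E → ℂ} (hf : AEStronglyMeasurable f μ) {q : ℝ} (hq : 1 ≤ q) :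
    ∫⁻ x, ‖avg P f x‖ₑ ^ q ∂μ ≤ ∫⁻ x, ‖f x‖ₑ ^ q ∂μ := by
  refine (lintegral_enorm_integral_rpow_le P (F := fun x t => f (x + t))
    (aestronglyMeasurable_comp_add hf) hq).trans ?_
  have : ∀ t, ∫⁻ x, ‖f (x + t)‖ₑ ^ q ∂μ = ∫⁻ x, ‖f x‖ₑ ^ q ∂μ := fun t => by
    simp_rw [add_comm _ t]
    exact lintegral_add_left_eq_self (fun x => ‖f x‖ₑ ^ q) t
  simp [this]

theorem memLp_avg {f : E → ℂ} (hf : MemLp f 2 μ) : MemLp (avg P f) 2 μ := by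
  rw [memLp_two_iff (aestronglyMeasurable_avg hf.1)]
  exact (lintegral_avg_rpow_le hf.1 one_le_two).trans_lt ((memLp_two_iff hf.1).1 hf)

theorem integrable_smul_comp_add [IsFiniteMeasureOnCompacts μ] {f : E → ℂ} (hf : MemLp f 2 μ)
    {φ : E → ℝ} (hφ : Continuous φ) (hφc : HasCompactSupport φ) :
    Integrable (fun z : E × E => φ z.1 • f (z.1 + z.2)) (μ.prod P) := by
  have hφ2 : MemLp φ 2 μ := hφ.memLp_of_hasCompactSupport hφc
  have h1 : Integrable (fun z : E × E => φ z.1 ^ 2) (μ.prod P) :=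
    MemLp.integrable_sq (f := fun z : E × E => φ z.1)
      (hφ2.comp_measurePreserving (measurePreserving_fst (μ := μ) (ν := P)))
  have h2 : Integrable (fun z : E × E => ‖f (z.1 + z.2)‖ ^ 2) (μ.prod P) :=
    (memLp_two_iff_integrable_sq_norm (aestronglyMeasurable_comp_add hf.1)).1
      (hf.comp_measurePreserving (measurePreserving_add_prob μ P))
  refine (h1.add h2).mono' ?_ (ae_of_all _ fun z => ?_)
  · exact ((hφ.comp continuous_fst).aestronglyMeasurable).smul
      (aestronglyMeasurable_comp_add hf.1)
  · simp only [norm_smul, Pi.add_apply, Real.norm_eq_abs]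
    rw [← sq_abs (φ z.1)]
    nlinarith [sq_nonneg (|φ z.1| - ‖f (z.1 + z.2)‖), sq_nonneg (|φ z.1|),
      sq_nonneg (‖f (z.1 + z.2)‖)]

theorem integrable_smul_comp_sub [IsFiniteMeasureOnCompacts μ] {f : E → ℂ} (hf : MemLp f 2 μ)
    {φ : E → ℝ} (hφ : Continuous φ) (hφc : HasCompactSupport φ) :
    Integrable (fun z : E × E => φ (z.1 - z.2) • f z.1) (μ.prod P) := by
  have he : MeasurableEmbedding (fun z : E × E => (z.1 + z.2, z.2)) :=
    (MeasurableEquiv.mk ⟨fun z : E × E => (z.1 + z.2, z.2), fun z => (z.1 - z.2, z.2),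
      fun z => by simp, fun z => by simp⟩ (by dsimp; fun_prop) (by dsimp; fun_prop)).measurableEmbedding
  rw [← (measurePreserving_shear μ P).integrable_comp_emb he]
  convert integrable_smul_comp_add (P := P) hf hφ hφc using 2 with z
  simp

theorem integral_smul_avg [IsFiniteMeasureOnCompacts μ] {f : E → ℂ} (hf : MemLp f 2 μ)
    {φ : E → ℝ} (hφ : Continuous φ) (hφc : HasCompactSupport φ) :
    ∫ x, φ x • avg P f x ∂μ = ∫ t, ∫ x, φ (x - t) • f x ∂μ ∂P := by
  have h1 : ∀ x, φ x • avg P f x = ∫ t, φ x • f (x + t) ∂P := fun x => (integral_smul _ _).symm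
  simp_rw [h1]
  rw [integral_integral_swap (integrable_smul_comp_add hf hφ hφc)]
  congr 1; ext t
  rw [← integral_add_left_eq_self (fun x => φ (x - t) • f x) t]
  simp [add_comm]

theorem integral_smul_avg' [IsFiniteMeasureOnCompacts μ] {f : E → ℂ} (hf : MemLp f 2 μ)
    {φ : E → ℝ} (hφ : Continuous φ) (hφc : HasCompactSupport φ) :
    ∫ x, φ x • avg P f x ∂μ = ∫ x, (∫ t, φ (x - t) ∂P) • f x ∂μ := by
  rw [integral_smul_avg hf hφ hφc,
    ← integral_integral_swap (integrable_smul_comp_sub hf hφ hφc)]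
  congr 1; ext x
  exact integral_smul_const (fun t => φ (x - t)) (f x)

end Avg

/-! ### Averages over segments and weak directional derivatives. -/

section Segment

variable {E : Type*} [NormedAddCommGroup E] [NormedSpace ℝ E] [MeasurableSpace E] [BorelSpace E]
  [SecondCountableTopology E]

/-- The uniform probability measure on the segment from `0` to `e`. -/
def segMeasure (e : E) : Measure E :=
  (volume.restrict (Set.Icc (0 : ℝ) 1)).map (fun s => s • e)

instance (e : E) : IsProbabilityMeasure (segMeasure e) := by
  have : IsProbabilityMeasure (volume.restrict (Set.Icc (0 : ℝ) 1)) := ⟨by simp⟩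
  exact Measure.isProbabilityMeasure_map (by fun_prop)

theorem ae_segMeasure {e : E} {p : E → Prop} (hp : MeasurableSet {t | p t})
    (h : ∀ s ∈ Set.Icc (0 : ℝ) 1, p (s • e)) : ∀ᵐ t ∂(segMeasure e), p t := by
  rw [segMeasure, ae_map_iff (by fun_prop) hp]
  exact (ae_restrict_iff' measurableSet_Icc).2 (ae_of_all _ h)

theorem integral_segMeasure_fderiv (e : E) {φ : E → ℝ} (hφ : ContDiff ℝ ∞ φ) (x : E) :
    ∫ t, fderiv ℝ φ (x - t) e ∂(segMeasure e) = φ x - φ (x - e) := by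
  have hc : Continuous (fun t => fderiv ℝ φ (x - t) e) :=
    ((hφ.continuous_fderiv (by simp)).comp (by fun_prop)).clm_apply continuous_const
  rw [segMeasure, integral_map (by fun_prop) hc.aestronglyMeasurable,
    integral_Icc_eq_integral_Ioc, ← intervalIntegral.integral_of_le zero_le_one]
  have hd : ∀ s ∈ Set.uIcc (0 : ℝ) 1, HasDerivAt (fun s : ℝ => - φ (x - s • e))
      (fderiv ℝ φ (x - s • e) e) s := fun s _ => by
    have h1 : HasDerivAt (fun s : ℝ => x - s • e) (-e) s := by
      simpa using ((hasDerivAt_id s).smul_const e).const_sub x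
    have h2 := ((hφ.differentiable (by simp)) (x - s • e)).hasFDerivAt.comp_hasDerivAt s h1
    simpa [Function.comp_def, Pi.neg_def] using h2.neg
  rw [intervalIntegral.integral_eq_sub_of_hasDerivAt hd]
  · simp only [one_smul, zero_smul, sub_zero]; ring
  · exact (hc.comp (by fun_prop : Continuous fun s : ℝ => s • e)).intervalIntegrable _ _

variable {μ : Measure E} [SFinite μ] [μ.IsAddLeftInvariant] [IsFiniteMeasureOnCompacts μ]

/-- The averaging is moved onto φ, where the fundamental theorem of calculus along the segment turns
it into a difference. Thus the segment average of any L² function has a weak derivative along e,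
namely its increment. This serves both the difference quotients of H¹ functions and the construction
of the interpolant. -/
theorem integral_fderiv_smul_avg_segMeasure {w : E → ℂ} (hw : MemLp w 2 μ) (e : E)
    {φ : E → ℝ} (hφ : ContDiff ℝ ∞ φ) (hφc : HasCompactSupport φ) :
    ∫ x, (fderiv ℝ φ x e) • avg (segMeasure e) w x ∂μ = - ∫ x, φ x • (w (x + e) - w x) ∂μ := by
  have hc : Continuous (fun x => fderiv ℝ φ x e) :=
    (hφ.continuous_fderiv (by simp)).clm_apply continuous_const
  have hcc : HasCompactSupport (fun x => fderiv ℝ φ x e) := hφc.fderiv_apply (𝕜 := ℝ) e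
  have hφ2 : MemLp φ 2 μ := hφ.continuous.memLp_of_hasCompactSupport hφc
  have hint : ∀ {u : E → ℂ}, MemLp u 2 μ → Integrable (fun x => φ x • u x) μ := fun hu =>
    memLp_one_iff_integrable.1 (MemLp.smul hu hφ2)
  have hw' : MemLp (fun x => w (x + e)) 2 μ :=
    hw.comp_measurePreserving (by
      simpa [add_comm] using measurePreserving_add_left μ e)
  rw [integral_smul_avg' hw hc hcc]
  simp_rw [integral_segMeasure_fderiv e hφ, smul_sub]
  rw [integral_sub (hint hw') (hint hw), neg_sub]
  have h3 : ∫ x, φ x • w (x + e) ∂μ = ∫ x, φ (x - e) • w x ∂μ := by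
    rw [← integral_add_left_eq_self (fun x => φ (x - e) • w x) e]
    simp [add_comm]
  rw [h3]
  simp_rw [sub_smul]
  refine integral_sub (hint hw) ?_
  have := (measurePreserving_add_left μ (-e)).integrable_comp_of_integrable (hint hw')
  refine this.congr (ae_of_all _ fun x => ?_)
  simp [sub_eq_add_neg, add_comm]

end Segment

/-! ### Difference quotients of H¹ functions. -/

section Translation

variable {d : ℕ}

theorem IsH1.sub_translate_ae {v : EuclideanSpace ℝ (Fin d) → ℂ}
    {g : Fin d → EuclideanSpace ℝ (Fin d) → ℂ} (hv : IsH1 v g) (h : ℝ) (i : Fin d) :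
    ∀ᵐ x, v (x + h • EuclideanSpace.single i 1) - v x =
      h • avg (segMeasure (h • EuclideanSpace.single i (1 : ℝ))) (g i) x := by
  set e : EuclideanSpace ℝ (Fin d) := h • EuclideanSpace.single i (1 : ℝ) with he
  have hv' : MemLp (fun x => v (x + e)) 2 volume :=
    hv.memLp.comp_measurePreserving (by
      simpa [add_comm] using measurePreserving_add_left volume e)
  refine ae_eq_of_integral_contDiff_smul_eq
    ((hv'.sub hv.memLp).locallyIntegrable one_le_two)
    (((memLp_avg (hv.memLp_grad i)).const_smul h).locallyIntegrable one_le_two)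
    fun φ hφ hφc => ?_
  have hc : Continuous (fun x => fderiv ℝ φ x e) :=
    (hφ.continuous_fderiv (by simp)).clm_apply continuous_const
  have hcc : HasCompactSupport (fun x => fderiv ℝ φ x e) := hφc.fderiv_apply (𝕜 := ℝ) e
  -- The pairing of ∂_e φ with the segment average of v is computed twice: here as an increment of
  -- v, and in `h2` by the weak gradient tested on translates of φ. No approximation of v by smooth
  -- functions is needed.
  have h1 := integral_fderiv_smul_avg_segMeasure hv.memLp e hφ hφc
  rw [integral_smul_avg hv.memLp hc hcc] at h1
  have h2 : ∀ t, ∫ x, (fderiv ℝ φ (x - t) e) • v x = - (h • ∫ x, φ (x - t) • g i x) := by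
    intro t
    have h3 := hv.weakGradient (fun x => φ (x - t)) (hφ.comp (contDiff_id.sub contDiff_const))
      (hφc.comp_homeomorph (Homeomorph.subRight t)) i
    have h4 : ∀ x, fderiv ℝ (fun x => φ (x - t)) x = fderiv ℝ φ (x - t) := fun x =>
      by rw [fderiv_comp_sub]
    simp_rw [h4] at h3
    rw [← smul_neg, ← h3, ← integral_smul]
    simp_rw [he, map_smul, smul_assoc]
  simp_rw [h2] at h1
  rw [integral_neg, neg_inj, integral_smul, ← integral_smul_avg (hv.memLp_grad i) hφ.continuous hφc]
    at h1
  refine h1.symm.trans ?_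
  rw [← integral_smul]
  exact integral_congr_ae (ae_of_all _ fun x => smul_comm _ _ _)

theorem IsH1.lintegral_sub_translate_le {v : EuclideanSpace ℝ (Fin d) → ℂ}
    {g : Fin d → EuclideanSpace ℝ (Fin d) → ℂ} (hv : IsH1 v g) (h : ℝ) (i : Fin d) :
    ∫⁻ x, ‖v (x + h • EuclideanSpace.single i 1) - v x‖ₑ ^ (2 : ℝ) ≤
      ENNReal.ofReal (h ^ 2) * ∫⁻ x, ‖g i x‖ₑ ^ (2 : ℝ) := by
  have h0 : ∀ z : ℂ, ‖h • z‖ₑ ^ (2 : ℝ) = ENNReal.ofReal (h ^ 2) * ‖z‖ₑ ^ (2 : ℝ) := fun z => by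
    rw [enorm_smul, ENNReal.mul_rpow_of_nonneg _ _ zero_le_two, ← sq_abs, ← Real.norm_eq_abs,
      ENNReal.ofReal_pow (norm_nonneg _), ofReal_norm]
    norm_cast
  calc _ = ∫⁻ x, ENNReal.ofReal (h ^ 2) *
        ‖avg (segMeasure (h • EuclideanSpace.single i (1 : ℝ))) (g i) x‖ₑ ^ (2 : ℝ) :=
        lintegral_congr_ae ((hv.sub_translate_ae h i).mono fun x hx => by
          dsimp only; rw [hx, h0])
    _ ≤ _ := by
        rw [lintegral_const_mul' _ _ ENNReal.ofReal_ne_top]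
        exact mul_le_mul' le_rfl
          (lintegral_avg_rpow_le (P := segMeasure (h • EuclideanSpace.single i (1 : ℝ)))
            (hv.memLp_grad i).1 one_le_two)

end Translation

end

section

/-! ### Lattice functions as step functions -/

/-- The integral of `|f|^q`. -/
def powInt {X : Type*} [MeasurableSpace X] (q : ℝ) (f : X → ℂ) (μ : Measure X) : ENNReal :=
  ∫⁻ x, ‖f x‖ₑ ^ q ∂μ

variable {d : ℕ}

/-- The index of the cell of side `h` that contains `x`. -/
def cellIndex (h : ℝ) (x : EuclideanSpace ℝ (Fin d)) : Fin d → ℤ := fun i => ⌊x i / h⌋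

theorem measurable_cellIndex (h : ℝ) :
    Measurable (cellIndex h : EuclideanSpace ℝ (Fin d) → Fin d → ℤ) := by
  unfold cellIndex
  fun_prop

theorem cellIndex_add (h : ℝ) (hh : 0 < h) (x : EuclideanSpace ℝ (Fin d)) (i : Fin d) :
    cellIndex h (x + h • EuclideanSpace.single i 1) = cellIndex h x + Pi.single i 1 := by
  ext j
  by_cases hj : j = i
  · subst hj
    simp [cellIndex, add_div, hh.ne']
  · simp [cellIndex, hj]

/-- A move of length at most h in a coordinate direction crosses at most one cell wall. -/
theorem cellIndex_add_smul {h : ℝ} (hh : 0 < h) (x : EuclideanSpace ℝ (Fin d)) (i : Fin d)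
    {s : ℝ} (hs : s ∈ Set.Icc (0 : ℝ) 1) :
    cellIndex h (x + s • h • EuclideanSpace.single i 1) = cellIndex h x ∨
      cellIndex h (x + s • h • EuclideanSpace.single i 1) = cellIndex h x + Pi.single i 1 := by
  have hj : ∀ j, j ≠ i → cellIndex h (x + s • h • EuclideanSpace.single i 1) j =
      cellIndex h x j := fun j hj => by simp [cellIndex, hj]
  have hi : cellIndex h (x + s • h • EuclideanSpace.single i 1) i = ⌊x i / h + s⌋ := by
    simp [cellIndex, add_div, hh.ne']
  have h1 : ⌊x i / h⌋ ≤ ⌊x i / h + s⌋ := Int.floor_mono (by linarith [hs.1])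
  have h2 : ⌊x i / h + s⌋ ≤ ⌊x i / h⌋ + 1 := by
    rw [← Int.floor_add_one]; exact Int.floor_mono (by linarith [hs.2])
  rcases (by omega : ⌊x i / h + s⌋ = ⌊x i / h⌋ ∨ ⌊x i / h + s⌋ = ⌊x i / h⌋ + 1) with h3 | h3
  · left; ext j
    by_cases hij : j = i
    · subst hij; rw [hi, h3]; rfl
    · exact hj j hij
  · right; ext j
    by_cases hij : j = i
    · subst hij; rw [hi, h3]; simp [cellIndex]
    · rw [hj j hij]; simp [hij]

theorem ofLp_image_cellIndex_preimage {h : ℝ} (hh : 0 < h) (k : Fin d → ℤ) :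
    (cellIndex h ⁻¹' {k} : Set (EuclideanSpace ℝ (Fin d))) =
      WithLp.ofLp ⁻¹' (Set.univ.pi fun i => Set.Ico (k i * h) ((k i + 1) * h)) := by
  ext x
  simp only [Set.mem_preimage, Set.mem_singleton_iff, funext_iff, cellIndex, Int.floor_eq_iff,
    Set.mem_pi, Set.mem_univ, true_implies, Set.mem_Ico, le_div_iff₀ hh, div_lt_iff₀ hh]

theorem volume_cellIndex_preimage {h : ℝ} (hh : 0 < h) (k : Fin d → ℤ) :
    volume (cellIndex h ⁻¹' {k} : Set (EuclideanSpace ℝ (Fin d))) = ENNReal.ofReal (h ^ d) := by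
  rw [ofLp_image_cellIndex_preimage hh, (PiLp.volume_preserving_ofLp (Fin d)).measure_preimage
    (MeasurableSet.univ_pi fun i => measurableSet_Ico).nullMeasurableSet, Real.volume_pi_Ico]
  simp [add_mul, ENNReal.ofReal_pow hh.le]

theorem map_cellIndex_volume {h : ℝ} (hh : 0 < h) :
    (volume : Measure (EuclideanSpace ℝ (Fin d))).map (cellIndex h) =
      ENNReal.ofReal (h ^ d) • Measure.count := by
  refine Measure.ext_of_singleton fun k => ?_
  rw [Measure.map_apply (measurable_cellIndex h) (MeasurableSet.singleton k),
    volume_cellIndex_preimage hh]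
  simp

theorem lintegral_comp_cellIndex {h : ℝ} (hh : 0 < h) (F : (Fin d → ℤ) → ENNReal) :
    ∫⁻ x : EuclideanSpace ℝ (Fin d), F (cellIndex h x) = ENNReal.ofReal (h ^ d) * ∑' k, F k := by
  rw [← lintegral_map (measurable_of_countable F) (measurable_cellIndex h),
    map_cellIndex_volume hh, lintegral_smul_measure, lintegral_count, smul_eq_mul]

/-- The function on `ℝ^d` that is constant on the cells of side `h`, with the values of `v`. -/
def stepFn (h : ℝ) (v : (Fin d → ℤ) → ℂ) (x : EuclideanSpace ℝ (Fin d)) : ℂ := v (cellIndex h x)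

theorem measurable_stepFn (h : ℝ) (v : (Fin d → ℤ) → ℂ) : Measurable (stepFn h v) :=
  (measurable_of_countable v).comp (measurable_cellIndex h)

/-- The difference of `v` with its neighbour in direction `i`. -/
def latticeDiff (i : Fin d) (v : (Fin d → ℤ) → ℂ) (x : Fin d → ℤ) : ℂ :=
  v (x + Pi.single i 1) - v x

theorem stepFn_latticeDiff {h : ℝ} (hh : 0 < h) (i : Fin d) (v : (Fin d → ℤ) → ℂ)
    (x : EuclideanSpace ℝ (Fin d)) :
    stepFn h (latticeDiff i v) x =
      stepFn h v (x + h • EuclideanSpace.single i 1) - stepFn h v x := by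
  simp [stepFn, latticeDiff, cellIndex_add h hh]

theorem powInt_stepFn {h : ℝ} (hh : 0 < h) (q : ℝ) (v : (Fin d → ℤ) → ℂ) :
    powInt q (stepFn h v) volume = ENNReal.ofReal (h ^ d) * powInt q v Measure.count := by
  rw [powInt, powInt, lintegral_count]
  exact lintegral_comp_cellIndex hh (fun k => ‖v k‖ₑ ^ q)

theorem toReal_powInt_stepFn {h : ℝ} (hh : 0 < h) {q : ℝ} (hq : 0 ≤ q) (v : (Fin d → ℤ) → ℂ) :
    (powInt q (stepFn h v) volume).toReal = h ^ d * ∑' x, ‖v x‖ ^ q := by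
  rw [powInt_stepFn hh, powInt, lintegral_count, ENNReal.toReal_mul,
    ENNReal.toReal_ofReal (by positivity), ENNReal.tsum_toReal_eq
      (fun a => ENNReal.rpow_ne_top_of_nonneg hq enorm_ne_top)]
  simp_rw [← ENNReal.toReal_rpow, toReal_enorm]

theorem powInt_count_ne_top_iff {q : ℝ} (hq : 0 ≤ q) {v : (Fin d → ℤ) → ℂ} :
    powInt q v Measure.count ≠ ⊤ ↔ Summable (fun x => ‖v x‖ ^ q) := by
  rw [powInt, lintegral_count]
  refine ⟨fun H => ?_, fun H => ?_⟩
  · simpa [← ENNReal.toReal_rpow] using ENNReal.summable_toReal H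
  · have := H.tsum_ofReal_ne_top
    simpa [← ENNReal.ofReal_rpow_of_nonneg (norm_nonneg _) hq] using this

theorem integral_norm_rpow_eq {X : Type*} [MeasurableSpace X] {μ : Measure X} {f : X → ℂ}
    (hf : AEStronglyMeasurable f μ) {q : ℝ} (hq : 0 ≤ q) :
    ∫ x, ‖f x‖ ^ q ∂μ = (powInt q f μ).toReal := by
  rw [integral_eq_lintegral_of_nonneg_ae (ae_of_all _ fun x => by positivity)
    (hf.norm.aemeasurable.pow_const q).aestronglyMeasurable, powInt]
  simp_rw [← ENNReal.ofReal_rpow_of_nonneg (norm_nonneg _) hq, ofReal_norm]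

theorem powInt_ne_top_iff {X : Type*} [MeasurableSpace X] {μ : Measure X} {f : X → ℂ}
    (hf : AEStronglyMeasurable f μ) {q : ℝ} (hq : 0 ≤ q) :
    powInt q f μ ≠ ⊤ ↔ Integrable (fun x => ‖f x‖ ^ q) μ := by
  rw [Integrable, and_iff_right (hf.norm.aemeasurable.pow_const q).aestronglyMeasurable,
    hasFiniteIntegral_iff_enorm, lt_top_iff_ne_top, powInt]
  simp_rw [← ofReal_norm, Real.norm_of_nonneg (Real.rpow_nonneg (norm_nonneg _) q),
    ENNReal.ofReal_rpow_of_nonneg (norm_nonneg _) hq]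

theorem latticeMass_eq {h : ℝ} (hh : 0 < h) (v : (Fin d → ℤ) → ℂ) :
    latticeMass h v = (powInt 2 (stepFn h v) volume).toReal := by
  rw [toReal_powInt_stepFn hh zero_le_two, latticeMass]
  norm_cast

theorem mass_eq {v : EuclideanSpace ℝ (Fin d) → ℂ} (hv : AEStronglyMeasurable v volume) :
    mass v = (powInt 2 v volume).toReal := by
  rw [← integral_norm_rpow_eq hv zero_le_two, mass]
  norm_cast

theorem summable_latticeDiff {v : (Fin d → ℤ) → ℂ} (hv : Summable (fun x => ‖v x‖ ^ 2))
    (i : Fin d) : Summable (fun x => ‖latticeDiff i v x‖ ^ 2) := by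
  have h1 : Summable (fun x : Fin d → ℤ => ‖v (x + Pi.single i 1)‖ ^ 2) :=
    hv.comp_injective (add_left_injective _)
  refine Summable.of_nonneg_of_le (fun x => by positivity) (fun x => ?_)
    ((h1.mul_left 2).add (hv.mul_left 2))
  have := norm_sub_le (v (x + Pi.single i 1)) (v x)
  have h3 : ‖latticeDiff i v x‖ ^ 2 ≤ (‖v (x + Pi.single i 1)‖ + ‖v x‖) ^ 2 := by
    gcongr; exact this
  nlinarith [sq_nonneg (‖v (x + Pi.single i 1)‖ - ‖v x‖)]

/-- The discrete Dirichlet energy, as a sum of integrals of step functions. -/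
def latticeKin (h : ℝ) (v : (Fin d → ℤ) → ℂ) : ℝ :=
  ∑ i, (powInt 2 (stepFn h (latticeDiff i v)) volume).toReal / h ^ 2

theorem latticeEnergy_eq {h : ℝ} (hh : 0 < h) {p : ℝ} (hp : 0 ≤ p + 1) {v : (Fin d → ℤ) → ℂ}
    (hv : Summable (fun x => ‖v x‖ ^ 2)) :
    latticeEnergy p h v = 1 / 2 * latticeKin h v
      - 1 / (p + 1) * (powInt (p + 1) (stepFn h v) volume).toReal := by
  rw [toReal_powInt_stepFn hh hp, latticeEnergy, latticeKin]
  simp_rw [toReal_powInt_stepFn hh zero_le_two]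
  have h1 : ∀ (x : Fin d → ℤ) (i : Fin d), ‖(v (x + Pi.single i 1) - v x) / (h : ℂ)‖ ^ 2 =
      ‖latticeDiff i v x‖ ^ 2 / h ^ 2 := fun x i => by
    rw [norm_div, div_pow, latticeDiff]; simp
  simp_rw [h1]
  rw [Summable.tsum_finsetSum fun i _ => (summable_latticeDiff hv i).div_const _]
  simp_rw [tsum_div_const, mul_div_assoc, Finset.mul_sum]
  norm_num
  congr 1
  · refine Finset.sum_congr rfl fun i _ => by ring
  · ring

theorem energy_eq {p : ℝ} (hp : 0 ≤ p + 1) {v : EuclideanSpace ℝ (Fin d) → ℂ}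
    {g : Fin d → EuclideanSpace ℝ (Fin d) → ℂ} (hv : AEStronglyMeasurable v volume)
    (hg : ∀ i, MemLp (g i) 2 volume) :
    energy p v g = 1 / 2 * ∑ i, (powInt 2 (g i) volume).toReal
      - 1 / (p + 1) * (powInt (p + 1) v volume).toReal := by
  rw [energy, integral_norm_rpow_eq hv hp, integral_finsetSum]
  · congr 3
    ext i
    rw [← integral_norm_rpow_eq (hg i).1 zero_le_two]
    norm_cast
  · exact fun i _ => (memLp_two_iff_integrable_sq_norm (hg i).1).1 (hg i)

end

section

set_option linter.unusedSectionVars false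

/-! ### Translations in `L^q` -/

section Translate

variable {G : Type*} [AddCommGroup G] [MeasurableSpace G] [MeasurableAdd G] {μ : Measure G}
  [μ.IsAddLeftInvariant]

theorem measurePreserving_add_right' (y : G) : MeasurePreserving (fun x => x + y) μ μ := by
  simpa [add_comm] using measurePreserving_add_left μ y

theorem eLpNorm_comp_add {f : G → ℂ} (hf : AEStronglyMeasurable f μ) (q : ENNReal) (y : G) :
    eLpNorm (fun x => f (x + y)) q μ = eLpNorm f q μ :=
  eLpNorm_comp_measurePreserving hf (measurePreserving_add_right' y)

/-- The `L^q` distance of `f` to its translate by `y`. -/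
def transNorm (f : G → ℂ) (q : ENNReal) (μ : Measure G) (y : G) : ENNReal :=
  eLpNorm (fun x => f (x + y) - f x) q μ

theorem transNorm_zero (f : G → ℂ) (q : ENNReal) : transNorm f q μ 0 = 0 := by
  simp [transNorm]

theorem transNorm_add_le {f : G → ℂ} (hf : AEStronglyMeasurable f μ) {q : ENNReal} (hq : 1 ≤ q)
    (y z : G) : transNorm f q μ (y + z) ≤ transNorm f q μ y + transNorm f q μ z := by
  have hm : ∀ y, AEStronglyMeasurable (fun x => f (x + y)) μ := fun y =>
    hf.comp_measurePreserving (measurePreserving_add_right' y)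
  have h1 : (fun x => f (x + (y + z)) - f x) =
      (fun x => f (x + y) - f x) + (fun x => (fun x => f (x + z) - f x) (x + y)) := by
    ext x; simp [add_assoc]
  rw [transNorm, h1]
  refine (eLpNorm_add_le ((hm y).sub hf) ?_ hq).trans ?_
  · exact ((hm z).sub hf).comp_measurePreserving (measurePreserving_add_right' y)
  · exact add_le_add le_rfl
      (eLpNorm_comp_add (f := fun x => f (x + z) - f x) ((hm z).sub hf) q y).le

theorem transNorm_nsmul_le {f : G → ℂ} (hf : AEStronglyMeasurable f μ) {q : ENNReal} (hq : 1 ≤ q)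
    (n : ℕ) (y : G) : transNorm f q μ (n • y) ≤ n * transNorm f q μ y := by
  induction n with
  | zero => simp [transNorm_zero]
  | succ n ih =>
    rw [succ_nsmul]
    refine (transNorm_add_le hf hq _ _).trans ?_
    push_cast
    rw [add_mul, one_mul]
    gcongr

theorem transNorm_sum_le {f : G → ℂ} (hf : AEStronglyMeasurable f μ) {q : ENNReal} (hq : 1 ≤ q)
    {ι : Type*} (s : Finset ι) (y : ι → G) :
    transNorm f q μ (∑ i ∈ s, y i) ≤ ∑ i ∈ s, transNorm f q μ (y i) :=
  Finset.le_sum_of_subadditive _ (transNorm_zero f q).le (transNorm_add_le hf hq) s y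

theorem eLpNorm_ofReal_rpow {X : Type*} [MeasurableSpace X] {μ : Measure X} {q : ℝ} (hq : 0 < q)
    (f : X → ℂ) : eLpNorm f (ENNReal.ofReal q) μ ^ q = powInt q f μ := by
  rw [eLpNorm_eq_lintegral_rpow_enorm_toReal (by simpa using hq) (by simp),
    ENNReal.toReal_ofReal hq.le, ← ENNReal.rpow_mul, one_div_mul_cancel hq.ne', ENNReal.rpow_one,
    powInt]

theorem transNorm_rpow {q : ℝ} (hq : 0 < q) (f : G → ℂ) (y : G) :
    transNorm f (ENNReal.ofReal q) μ y ^ q = powInt q (fun x => f (x + y) - f x) μ :=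
  eLpNorm_ofReal_rpow hq _

end Translate

/-! ### The Gagliardo-Nirenberg inequality on the lattice -/

variable {d : ℕ}

/-- The translation by y is a composition of at most N unit steps in each direction, so the triangle
inequality bounds the L² norm by N ∑ ‖D_i v‖; Cauchy-Schwarz over the d directions gives the factor
d. -/
theorem powInt_translate_le (v : (Fin d → ℤ) → ℂ) {N : ℕ} {y : Fin d → ℕ} (hy : ∀ i, y i ≤ N) :
    powInt 2 (fun x => v (x + fun i => (y i : ℤ)) - v x) Measure.count ≤
      (N : ENNReal) ^ 2 * (d * ∑ i, powInt 2 (latticeDiff i v) Measure.count) := by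
  have hm : AEStronglyMeasurable v Measure.count :=
    (measurable_of_countable v).aestronglyMeasurable
  have h2 : (1 : ENNReal) ≤ ENNReal.ofReal 2 := by simp
  have hy' : (fun i => (y i : ℤ)) = ∑ i, y i • (Pi.single i 1 : Fin d → ℤ) := by
    ext j; simp [Finset.sum_apply, Pi.single_apply]
  rw [← transNorm_rpow zero_lt_two, hy']
  have h3 : transNorm v (ENNReal.ofReal 2) Measure.count (∑ i, y i • (Pi.single i 1 : Fin d → ℤ)) ≤
      ∑ i, N * transNorm v (ENNReal.ofReal 2) Measure.count (Pi.single i 1 : Fin d → ℤ) :=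
    (transNorm_sum_le hm h2 _ _).trans (Finset.sum_le_sum fun i _ =>
      (transNorm_nsmul_le hm h2 _ _).trans (by gcongr; exact_mod_cast hy i))
  have h4 : ∀ i, powInt 2 (latticeDiff i v) Measure.count =
      transNorm v (ENNReal.ofReal 2) Measure.count (Pi.single i 1 : Fin d → ℤ) ^ (2 : ℝ) :=
    fun i => (transNorm_rpow zero_lt_two _ _).symm
  simp_rw [h4]
  calc _ ≤ (∑ i, N * transNorm v (ENNReal.ofReal 2) Measure.count
        (Pi.single i 1 : Fin d → ℤ)) ^ (2 : ℝ) := by gcongr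
    _ = (N : ENNReal) ^ 2 * (∑ i, transNorm v (ENNReal.ofReal 2) Measure.count
        (Pi.single i 1 : Fin d → ℤ)) ^ (2 : ℝ) := by
      rw [← Finset.mul_sum, ENNReal.mul_rpow_of_nonneg _ _ zero_le_two]
      norm_cast
    _ ≤ _ := by
      gcongr
      refine (ENNReal.rpow_sum_le_const_mul_sum_rpow _ _ one_le_two).trans ?_
      norm_num

/-- A box of N^d points based at x carries at most the total mass, which by `hx` is a quarter of N^d
|v(x)|². Averaged over the box, v must then differ substantially from v(x): use |v(x)|² ≤ 2|v(x+y) -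
v(x)|² + 2|v(x+y)|² and absorb half of the left side. -/
theorem mul_norm_sq_le_sum_translate {v : (Fin d → ℤ) → ℂ} (hv : Summable (fun x => ‖v x‖ ^ 2))
    {N : ℕ} {x : Fin d → ℤ} (hx : 4 * ∑' x, ‖v x‖ ^ 2 ≤ N ^ d * ‖v x‖ ^ 2) :
    N ^ d * ‖v x‖ ^ 2 ≤
      4 * ∑ y : Fin d → Fin N, ‖v (x + fun i => ((y i : ℕ) : ℤ)) - v x‖ ^ 2 := by
  have h1 : ∑ y : Fin d → Fin N, ‖v (x + fun i => ((y i : ℕ) : ℤ))‖ ^ 2 ≤ ∑' x, ‖v x‖ ^ 2 := by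
    have hinj : Function.Injective (fun y : Fin d → Fin N => x + fun i => ((y i : ℕ) : ℤ)) := by
      intro y z hyz
      ext i
      simpa using congr_fun hyz i
    calc _ = ∑ k ∈ Finset.univ.map ⟨_, hinj⟩, ‖v k‖ ^ 2 := by simp
      _ ≤ _ := hv.sum_le_tsum _ fun _ _ => by positivity
  have h2 : N ^ d * ‖v x‖ ^ 2 = ∑ y : Fin d → Fin N, ‖v x‖ ^ 2 := by simp
  have h3 : ∑ y : Fin d → Fin N, ‖v x‖ ^ 2 ≤ ∑ y : Fin d → Fin N,
      (2 * ‖v (x + fun i => ((y i : ℕ) : ℤ)) - v x‖ ^ 2 +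
        2 * ‖v (x + fun i => ((y i : ℕ) : ℤ))‖ ^ 2) := by
    refine Finset.sum_le_sum fun y _ => ?_
    set b := v (x + fun i => ((y i : ℕ) : ℤ))
    have : ‖v x‖ ≤ ‖b - v x‖ + ‖b‖ := by
      have := norm_sub_le b (b - v x)
      simp only [sub_sub_cancel] at this
      linarith
    nlinarith [sq_nonneg (‖b - v x‖ - ‖b‖), norm_nonneg (v x)]
  rw [Finset.sum_add_distrib, ← Finset.mul_sum, ← Finset.mul_sum, ← h2] at h3
  linarith

/-- The pointwise bound is summed over the superlevel set and the sums over x and y exchanged; the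
N^d translates then cancel the factor N^d. -/
theorem tsum_indicator_mul_le {v : (Fin d → ℤ) → ℂ} (hv : Summable (fun x => ‖v x‖ ^ 2))
    {N : ℕ} (hN : 0 < N) {l : ℝ} (hl : 0 < l) (h : 4 * ∑' x, ‖v x‖ ^ 2 ≤ N ^ d * l ^ 2) :
    (∑' x, Set.indicator {x | l ≤ ‖v x‖} (fun _ => (1 : ENNReal)) x) * ENNReal.ofReal (l ^ 2) ≤
      4 * ((N : ENNReal) ^ 2 * (d * ∑ i, powInt 2 (latticeDiff i v) Measure.count)) := by
  set D := (N : ENNReal) ^ 2 * (d * ∑ i, powInt 2 (latticeDiff i v) Measure.count)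
  have hN0 : (N : ENNReal) ^ d ≠ 0 := by positivity
  have hNt : (N : ENNReal) ^ d ≠ ⊤ := by finiteness
  rw [← ENNReal.mul_le_mul_iff_right hN0 hNt]
  calc _ = ∑' x, (N : ENNReal) ^ d *
        (Set.indicator {x | l ≤ ‖v x‖} (fun _ => (1 : ENNReal)) x * ENNReal.ofReal (l ^ 2)) := by
        rw [ENNReal.tsum_mul_left, ENNReal.tsum_mul_right]
    _ ≤ ∑' x, ∑ y : Fin d → Fin N,
        4 * ‖v (x + fun i => ((y i : ℕ) : ℤ)) - v x‖ₑ ^ (2 : ℝ) := by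
      refine ENNReal.tsum_le_tsum fun x => ?_
      by_cases hx : l ≤ ‖v x‖
      · rw [Set.indicator_of_mem (by exact hx), one_mul]
        have h1 : N ^ d * l ^ 2 ≤ N ^ d * ‖v x‖ ^ 2 := by gcongr
        have h2 := h1.trans (mul_norm_sq_le_sum_translate hv (h.trans h1))
        calc (N : ENNReal) ^ d * ENNReal.ofReal (l ^ 2) = ENNReal.ofReal (N ^ d * l ^ 2) := by
              rw [ENNReal.ofReal_mul (by positivity), ENNReal.ofReal_pow (by positivity)]; simp
          _ ≤ _ := ENNReal.ofReal_le_ofReal h2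
          _ = _ := by
            rw [Finset.mul_sum, ENNReal.ofReal_sum_of_nonneg fun _ _ => by positivity]
            refine Finset.sum_congr rfl fun y _ => ?_
            rw [ENNReal.ofReal_mul (by norm_num), ENNReal.ofReal_pow (norm_nonneg _), ofReal_norm]
            norm_num
      · rw [Set.indicator_of_notMem (by exact hx)]; simp
    _ = ∑ y : Fin d → Fin N,
        4 * powInt 2 (fun x => v (x + fun i => ((y i : ℕ) : ℤ)) - v x) Measure.count := by
      rw [Summable.tsum_finsetSum fun _ _ => ENNReal.summable]
      simp_rw [ENNReal.tsum_mul_left, powInt, lintegral_count]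
    _ ≤ ∑ y : Fin d → Fin N, 4 * D := by
      gcongr with y
      exact powInt_translate_le v (y := fun i => (y i : ℕ)) fun i => (y i).2.le
    _ = _ := by simp

/-- N is (4S/l²)^{1/d} rounded up. The condition l² ≤ S makes this root at least 1, so rounding
costs at most a factor 2. -/
theorem exists_nat_box_side (hd : 1 ≤ d) {S l : ℝ} (hl : 0 < l) (hS : l ^ 2 ≤ S) :
    ∃ N : ℕ, 0 < N ∧ 4 * S ≤ N ^ d * l ^ 2 ∧
      (N : ℝ) ^ 2 ≤ 4 * (4 * S) ^ (2 / d : ℝ) * l ^ (-4 / d : ℝ) := by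
  have hd0 : (0 : ℝ) < d := by exact_mod_cast hd
  have hS0 : 0 < S := lt_of_lt_of_le (by positivity) hS
  set a : ℝ := 4 * S / l ^ 2 with ha
  have ha1 : 1 ≤ a := by rw [ha, le_div_iff₀ (by positivity)]; linarith
  have hb1 : 1 ≤ a ^ (1 / d : ℝ) := Real.one_le_rpow ha1 (by positivity)
  refine ⟨⌈a ^ (1 / d : ℝ)⌉₊, Nat.ceil_pos.2 (by linarith), ?_, ?_⟩
  · rw [← div_le_iff₀ (by positivity), ← ha]
    calc a = (a ^ (1 / d : ℝ)) ^ d := by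
          rw [← Real.rpow_natCast, ← Real.rpow_mul (by positivity), one_div_mul_cancel hd0.ne',
            Real.rpow_one]
      _ ≤ _ := by gcongr; exact Nat.le_ceil _
  · have h1 : (⌈a ^ (1 / d : ℝ)⌉₊ : ℝ) ≤ 2 * a ^ (1 / d : ℝ) := by
      have := (Nat.ceil_lt_add_one (by positivity : 0 ≤ a ^ (1 / d : ℝ))).le
      linarith
    have h2 : (a ^ (1 / d : ℝ)) ^ 2 = (4 * S) ^ (2 / d : ℝ) * l ^ (-4 / d : ℝ) := by
      rw [← Real.rpow_natCast, ← Real.rpow_mul (by positivity), ha,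
        Real.div_rpow (by positivity) (by positivity), ← Real.rpow_natCast l 2,
        ← Real.rpow_mul hl.le, div_eq_mul_inv, ← Real.rpow_neg hl.le]
      congr 2 <;> push_cast <;> ring
    calc _ ≤ (2 * a ^ (1 / d : ℝ)) ^ 2 := by gcongr
      _ = _ := by rw [mul_pow, h2]; ring

theorem tsum_indicator_le (hd : 1 ≤ d) {v : (Fin d → ℤ) → ℂ} (hv : Summable (fun x => ‖v x‖ ^ 2))
    {l : ℝ} (hl : 0 < l) :
    ∑' x, Set.indicator {x | l ≤ ‖v x‖} (fun _ => (1 : ENNReal)) x ≤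
      ENNReal.ofReal (l ^ (-2 - 4 / d : ℝ)) *
        (ENNReal.ofReal (16 * d * (4 * ∑' x, ‖v x‖ ^ 2) ^ (2 / d : ℝ)) *
          ∑ i, powInt 2 (latticeDiff i v) Measure.count) := by
  -- A point of the superlevel set forces l² ≤ ∑ |v|², as the choice of box side requires; otherwise
  -- the left side is 0.
  by_cases hne : ∃ x, l ≤ ‖v x‖
  · obtain ⟨x, hx⟩ := hne
    have hS : l ^ 2 ≤ ∑' x, ‖v x‖ ^ 2 :=
      (by gcongr : l ^ 2 ≤ ‖v x‖ ^ 2).trans (hv.le_tsum x fun _ _ => by positivity)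
    obtain ⟨N, hN, h1, h2⟩ := exists_nat_box_side hd hl hS
    have h3 := tsum_indicator_mul_le hv hN hl h1
    have hl2 : ENNReal.ofReal (l ^ 2) ≠ 0 := by simpa using hl.ne'
    rw [← ENNReal.mul_le_mul_iff_left hl2 ENNReal.ofReal_ne_top]
    refine h3.trans ?_
    have h4 : (N : ENNReal) ^ 2 = ENNReal.ofReal ((N : ℝ) ^ 2) := by
      rw [ENNReal.ofReal_pow (by positivity)]; simp
    set D := ∑ i, powInt 2 (latticeDiff i v) Measure.count
    set S := ∑' x, ‖v x‖ ^ 2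
    calc 4 * ((N : ENNReal) ^ 2 * (d * D)) = ENNReal.ofReal (4 * (N : ℝ) ^ 2 * d) * D := by
          rw [h4, ENNReal.ofReal_mul (by positivity), ENNReal.ofReal_mul (by positivity)]
          simp only [ENNReal.ofReal_ofNat, ENNReal.ofReal_natCast]
          ring
      _ ≤ ENNReal.ofReal (l ^ (-2 - 4 / d : ℝ) * (16 * d * (4 * S) ^ (2 / d : ℝ)) * l ^ 2) * D := by
          refine mul_le_mul' (ENNReal.ofReal_le_ofReal ?_) le_rfl
          have h5 : l ^ (-2 - 4 / d : ℝ) * l ^ 2 = l ^ (-4 / d : ℝ) := by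
            rw [← Real.rpow_natCast l 2, ← Real.rpow_add hl]; congr 1; push_cast; ring
          calc 4 * (N : ℝ) ^ 2 * d ≤ 4 * (4 * (4 * S) ^ (2 / d : ℝ) * l ^ (-4 / d : ℝ)) * d := by
                gcongr
            _ = _ := by rw [← h5]; ring
      _ = _ := by
          rw [ENNReal.ofReal_mul (by positivity), ENNReal.ofReal_mul (by positivity)]
          ring
  · have : {x | l ≤ ‖v x‖} = ∅ := by
      ext x; simpa using fun h => hne ⟨x, h⟩
    simp [this]

theorem enorm_rpow_le_dyadic {q L : ℝ} (hq : 2 < q) (hL : 0 < L) (z : ℂ) :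
    ‖z‖ₑ ^ q ≤ ENNReal.ofReal (L ^ (q - 2)) * ‖z‖ₑ ^ (2 : ℝ) +
      ∑' k : ℕ, ENNReal.ofReal ((2 ^ (k + 1) * L) ^ q) *
        (if 2 ^ k * L ≤ ‖z‖ then 1 else 0) := by
  rcases le_total ‖z‖ L with h | h
  · refine le_add_right ?_
    rcases eq_or_ne z 0 with rfl | hz
    · simp [show 0 < q by linarith]
    have hz0 : 0 < ‖z‖ := norm_pos_iff.2 hz
    rw [← ofReal_norm, ENNReal.ofReal_rpow_of_pos hz0, ENNReal.ofReal_rpow_of_pos hz0,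
      ← ENNReal.ofReal_mul (by positivity)]
    refine ENNReal.ofReal_le_ofReal ?_
    calc ‖z‖ ^ q = ‖z‖ ^ (q - 2) * ‖z‖ ^ (2 : ℝ) := by rw [← Real.rpow_add hz0]; ring_nf
      _ ≤ _ := by gcongr
  · refine le_add_left ?_
    obtain ⟨k, hk1, hk2⟩ := exists_nat_pow_near (x := ‖z‖ / L) (y := 2)
      (by rwa [le_div_iff₀ hL, one_mul]) one_lt_two
    rw [le_div_iff₀ hL] at hk1
    rw [div_lt_iff₀ hL] at hk2
    refine le_trans ?_ (ENNReal.le_tsum k)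
    rw [if_pos hk1, mul_one, ← ofReal_norm, ENNReal.ofReal_rpow_of_nonneg (norm_nonneg _)
      (by linarith)]
    exact ENNReal.ofReal_le_ofReal (by gcongr)

/-- The constant in the lattice Gagliardo-Nirenberg inequality. -/
def gnConst (d : ℕ) (q : ℝ) : ℝ :=
  2 ^ q * (∑' k : ℕ, ((2 : ℝ) ^ (q - 2 - 4 / d)) ^ k) * (16 * d * 4 ^ (2 / d : ℝ))

theorem gnConst_nonneg (d : ℕ) (q : ℝ) : 0 ≤ gnConst d q := by
  have : 0 ≤ ∑' k : ℕ, ((2 : ℝ) ^ (q - 2 - 4 / d)) ^ k := tsum_nonneg fun k => by positivity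
  unfold gnConst
  positivity

/-- Values below L are controlled by mass. Above L, the dyadic level 2^k L contributes at most its
q-th power times the superlevel count, of order (2^k L)^{q-2-4/d}; the sum over k is a geometric
series with ratio below 1 because q < 2 + 4/d. The threshold L stays free. -/
theorem powInt_le_of_lattice (hd : 1 ≤ d) {q L : ℝ} (hq : 2 < q) (hq' : q < 2 + 4 / d)
    (hL : 0 < L) {v : (Fin d → ℤ) → ℂ} (hv : Summable (fun x => ‖v x‖ ^ 2)) :
    powInt q v Measure.count ≤
      ENNReal.ofReal (L ^ (q - 2)) * powInt 2 v Measure.count +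
      ENNReal.ofReal (gnConst d q * (∑' x, ‖v x‖ ^ 2) ^ (2 / d : ℝ) * L ^ (q - 2 - 4 / d)) *
        ∑ i, powInt 2 (latticeDiff i v) Measure.count := by
  have hS0 : 0 ≤ ∑' x, ‖v x‖ ^ 2 := tsum_nonneg fun _ => by positivity
  set D := ∑ i, powInt 2 (latticeDiff i v) Measure.count with hD
  set S := ∑' x, ‖v x‖ ^ 2 with hS
  set W := ENNReal.ofReal (16 * d * (4 * S) ^ (2 / d : ℝ)) * D with hW
  simp only [powInt, lintegral_count]
  calc ∑' x, ‖v x‖ₑ ^ q ≤ ∑' x, (ENNReal.ofReal (L ^ (q - 2)) * ‖v x‖ₑ ^ (2 : ℝ) +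
      ∑' k : ℕ, ENNReal.ofReal ((2 ^ (k + 1) * L) ^ q) *
        (if 2 ^ k * L ≤ ‖v x‖ then 1 else 0)) :=
        ENNReal.tsum_le_tsum fun x => enorm_rpow_le_dyadic hq hL _
    _ = ENNReal.ofReal (L ^ (q - 2)) * ∑' x, ‖v x‖ₑ ^ (2 : ℝ) +
        ∑' k : ℕ, ENNReal.ofReal ((2 ^ (k + 1) * L) ^ q) *
          ∑' x, Set.indicator {x | 2 ^ k * L ≤ ‖v x‖} (fun _ => (1 : ENNReal)) x := by
        rw [ENNReal.tsum_add, ENNReal.tsum_mul_left, ENNReal.tsum_comm]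
        simp_rw [ENNReal.tsum_mul_left, Set.indicator_apply, Set.mem_ofPred_eq]
    _ ≤ ENNReal.ofReal (L ^ (q - 2)) * ∑' x, ‖v x‖ₑ ^ (2 : ℝ) +
        ∑' k : ℕ, ENNReal.ofReal ((2 ^ (k + 1) * L) ^ q) *
          (ENNReal.ofReal ((2 ^ k * L) ^ (-2 - 4 / d : ℝ)) * W) := by
        gcongr with k
        exact tsum_indicator_le hd hv (by positivity)
    _ = ENNReal.ofReal (L ^ (q - 2)) * ∑' x, ‖v x‖ₑ ^ (2 : ℝ) +
        (∑' k : ℕ, ENNReal.ofReal (2 ^ q * L ^ (q - 2 - 4 / d) *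
          ((2 : ℝ) ^ (q - 2 - 4 / d)) ^ k)) * W := by
        congr 1
        rw [← ENNReal.tsum_mul_right]
        congr 1; ext k
        rw [← mul_assoc, ← ENNReal.ofReal_mul (by positivity)]
        congr 2
        rw [pow_succ, mul_comm ((2 : ℝ) ^ k) 2, mul_assoc 2, Real.mul_rpow (by positivity)
          (by positivity), mul_assoc, ← Real.rpow_add (by positivity),
          Real.mul_rpow (by positivity) hL.le, ← Real.rpow_natCast 2 k,
          ← Real.rpow_natCast _ k, ← Real.rpow_mul zero_le_two, ← Real.rpow_mul zero_le_two]
        ring_nf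
    _ = _ := by
        congr 1
        have hgeo : Summable (fun k : ℕ => ((2 : ℝ) ^ (q - 2 - 4 / d)) ^ k) :=
          summable_geometric_of_lt_one (by positivity)
            (Real.rpow_lt_one_of_one_lt_of_neg one_lt_two (by linarith))
        have hgeo0 : 0 ≤ ∑' k : ℕ, ((2 : ℝ) ^ (q - 2 - 4 / d)) ^ k :=
          tsum_nonneg fun k => by positivity
        rw [← ENNReal.ofReal_tsum_of_nonneg (fun k => by positivity) (hgeo.mul_left _),
          tsum_mul_left, hW, ← mul_assoc, ← ENNReal.ofReal_mul (by positivity),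
          Real.mul_rpow (by norm_num) hS0, gnConst]
        congr 2
        ring

theorem powInt_stepFn_two_ne_top {h : ℝ} (hh : 0 < h) {v : (Fin d → ℤ) → ℂ}
    (hv : Summable (fun x => ‖v x‖ ^ 2)) : powInt 2 (stepFn h v) volume ≠ ⊤ := by
  rw [powInt_stepFn hh]
  refine ENNReal.mul_ne_top ENNReal.ofReal_ne_top ?_
  rw [powInt_count_ne_top_iff zero_le_two]
  exact_mod_cast hv

/-- All powers of h cancel: M_h^{2/d} supplies a factor h², which turns the unscaled differences
into the discrete Dirichlet energy. The constant is thus uniform in h. -/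
theorem powInt_stepFn_le (hd : 1 ≤ d) {q L h : ℝ} (hq : 2 < q) (hq' : q < 2 + 4 / d)
    (hL : 0 < L) (hh : 0 < h) {v : (Fin d → ℤ) → ℂ} (hv : Summable (fun x => ‖v x‖ ^ 2)) :
    powInt q (stepFn h v) volume ≤ ENNReal.ofReal (L ^ (q - 2) * latticeMass h v +
      gnConst d q * latticeMass h v ^ (2 / d : ℝ) * L ^ (q - 2 - 4 / d) * latticeKin h v) := by
  have hd0 : (0 : ℝ) < d := by exact_mod_cast hd
  have hK0 : 0 ≤ latticeKin h v := Finset.sum_nonneg fun i _ => by positivity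
  have hM0 : 0 ≤ latticeMass h v := by rw [latticeMass_eq hh]; positivity
  have hC := gnConst_nonneg d q
  have hS0 : 0 ≤ ∑' x, ‖v x‖ ^ 2 := tsum_nonneg fun _ => by positivity
  have h1 := powInt_le_of_lattice hd hq hq' hL hv
  have h2 : (∑' x, ‖v x‖ ^ 2) ^ (2 / d : ℝ) = latticeMass h v ^ (2 / d : ℝ) / h ^ 2 := by
    rw [latticeMass, Real.mul_rpow (by positivity) hS0, ← Real.rpow_natCast h d,
      ← Real.rpow_mul hh.le, mul_div_cancel₀ _ hd0.ne']
    norm_cast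
    field_simp
  have hK : ENNReal.ofReal (h ^ 2 * latticeKin h v) =
      ∑ i, powInt 2 (stepFn h (latticeDiff i v)) volume := by
    rw [latticeKin, Finset.mul_sum, ENNReal.ofReal_sum_of_nonneg fun _ _ => by positivity]
    refine Finset.sum_congr rfl fun i _ => ?_
    rw [mul_div_cancel₀ _ (by positivity), ENNReal.ofReal_toReal
      (powInt_stepFn_two_ne_top hh (summable_latticeDiff hv i))]
  have hM : ENNReal.ofReal (latticeMass h v) = powInt 2 (stepFn h v) volume := by
    rw [latticeMass_eq hh, ENNReal.ofReal_toReal (powInt_stepFn_two_ne_top hh hv)]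
  have h3 : gnConst d q * latticeMass h v ^ (2 / d : ℝ) * L ^ (q - 2 - 4 / d) * latticeKin h v =
      gnConst d q * (∑' x, ‖v x‖ ^ 2) ^ (2 / d : ℝ) * L ^ (q - 2 - 4 / d) *
        (h ^ 2 * latticeKin h v) := by
    rw [h2]; field_simp
  rw [h3, ENNReal.ofReal_add (by positivity) (by positivity), ENNReal.ofReal_mul (by positivity),
    ENNReal.ofReal_mul (by positivity), hK, hM, powInt_stepFn hh]
  simp_rw [powInt_stepFn hh, ← Finset.mul_sum]
  calc _ ≤ _ := mul_le_mul' le_rfl h1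
    _ = _ := by ring

end

section

/-! ### Interpolation of lattice functions -/

section Conv

variable {E : Type*} [NormedAddCommGroup E] [MeasurableSpace E] [BorelSpace E]
  [SecondCountableTopology E]

theorem integrable_of_bounded {X : Type*} [MeasurableSpace X] {P : Measure X} [IsFiniteMeasure P]
    {f : X → ℂ} (hf : Measurable f) {C : ℝ} (hC : ∀ x, ‖f x‖ ≤ C) : Integrable f P :=
  Integrable.of_bound hf.aestronglyMeasurable C (ae_of_all _ hC)

theorem avg_conv (P Q : Measure E) [IsProbabilityMeasure P] [IsProbabilityMeasure Q] {f : E → ℂ}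
    (hf : Measurable f) {C : ℝ} (hC : ∀ x, ‖f x‖ ≤ C) :
    avg (P ∗ Q) f = avg P (avg Q f) := by
  ext x
  have hm : Measurable (fun t => f (x + t)) := hf.comp (measurable_const_add x)
  simp only [avg]
  rw [Measure.conv, integral_map (by fun_prop) hm.aestronglyMeasurable, integral_prod]
  · simp_rw [add_assoc]
  · exact integrable_of_bounded (hm.comp (by fun_prop)) fun z => hC _

theorem ae_conv {P Q : Measure E} [IsProbabilityMeasure P] [IsProbabilityMeasure Q]
    {p₁ p₂ p : E → Prop} (hp : MeasurableSet {t | p t}) (h₁ : ∀ᵐ t ∂P, p₁ t) (h₂ : ∀ᵐ t ∂Q, p₂ t)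
    (h : ∀ s t, p₁ s → p₂ t → p (s + t)) : ∀ᵐ t ∂(P ∗ Q), p t := by
  rw [Measure.conv, ae_map_iff (by fun_prop) hp]
  filter_upwards [Measure.quasiMeasurePreserving_fst.ae h₁,
    Measure.quasiMeasurePreserving_snd.ae h₂] with z h3 h4
  exact h _ _ h3 h4

end Conv

variable {d : ℕ}

/-- P is the convolution of the uniform measures on the edges of length h in the directions of s. By
commutativity any one edge can be split off, which makes averages over P weakly differentiable in
that direction. The vanishing of the coordinates outside s is there for the induction. -/
theorem exists_box_measure {h : ℝ} (hh : 0 < h) (s : Finset (Fin d)) :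
    ∃ P : Measure (EuclideanSpace ℝ (Fin d)), IsProbabilityMeasure P ∧
      (∀ i ∈ s, ∃ Q : Measure (EuclideanSpace ℝ (Fin d)), IsProbabilityMeasure Q ∧
        P = segMeasure (h • EuclideanSpace.single i 1) ∗ Q) ∧
      ∀ᵐ t ∂P, ∀ j, (j ∈ s → t j ∈ Set.Icc 0 h) ∧ (j ∉ s → t j = 0) := by
  have hmeas : ∀ s : Finset (Fin d), MeasurableSet {t : EuclideanSpace ℝ (Fin d) |
      ∀ j, (j ∈ s → t j ∈ Set.Icc 0 h) ∧ (j ∉ s → t j = 0)} := by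
    intro s
    have hj : ∀ j, Measurable fun t : EuclideanSpace ℝ (Fin d) => t j := fun j => by fun_prop
    refine measurableSet_setOfPred.2 (Measurable.forall fun j => Measurable.and ?_ ?_)
    · by_cases hjs : j ∈ s
      · simpa [hjs] using measurableSet_setOfPred.1 ((hj j) measurableSet_Icc)
      · simp [hjs]
    · by_cases hjs : j ∈ s
      · simp [hjs]
      · simpa [hjs] using measurableSet_setOfPred.1 ((hj j) (measurableSet_singleton 0))
  induction s using Finset.induction_on with
  | empty =>
    refine ⟨Measure.dirac 0, inferInstance, by simp, ?_⟩
    rw [ae_dirac_iff (hmeas ∅)]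
    simp
  | insert i s hi ih =>
    obtain ⟨P, hP, hQ, hb⟩ := ih
    refine ⟨segMeasure (h • EuclideanSpace.single i 1) ∗ P, inferInstance, ?_, ?_⟩
    · intro j hj
      rcases Finset.mem_insert.1 hj with rfl | hj
      · exact ⟨P, hP, rfl⟩
      · obtain ⟨Q, hQ1, hQ2⟩ := hQ j hj
        refine ⟨segMeasure (h • EuclideanSpace.single i 1) ∗ Q, inferInstance, ?_⟩
        rw [hQ2, ← Measure.conv_assoc, ← Measure.conv_assoc]
        congr 1
        exact Measure.conv_comm _ _
    · have hseg := ae_segMeasure (e := h • EuclideanSpace.single i (1 : ℝ)) (hmeas {i})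
        fun c hc j => by
          by_cases hj : j = i
          · subst hj
            simpa using ⟨mul_nonneg hc.1 hh.le, mul_le_of_le_one_left hh.le hc.2⟩
          · simp [hj]
      refine ae_conv (hmeas _) hseg hb fun a t ha ht j => ?_
      by_cases hj : j = i
      · subst hj
        have h1 := (ha j).1 (Finset.mem_singleton_self j)
        simpa [(ht j).2 hi] using h1
      · have h1 := (ha j).2 (by simpa using hj)
        simpa [h1, hj] using ht j

/-- Pointwise, the increment of the step function is either 0 or the lattice difference of its cell.
-/
theorem transNorm_stepFn_smul_le {h : ℝ} (hh : 0 < h) (v : (Fin d → ℤ) → ℂ) (q : ENNReal)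
    (i : Fin d) {s : ℝ} (hs : s ∈ Set.Icc (0 : ℝ) 1) :
    transNorm (stepFn h v) q volume (s • h • EuclideanSpace.single i 1) ≤
      eLpNorm (stepFn h (latticeDiff i v)) q volume := by
  refine eLpNorm_mono fun x => ?_
  simp only [stepFn, latticeDiff]
  rcases cellIndex_add_smul hh x i hs with h1 | h1 <;> simp [h1]

theorem transNorm_stepFn_le {h : ℝ} (hh : 0 < h) (v : (Fin d → ℤ) → ℂ) {q : ENNReal} (hq : 1 ≤ q)
    {t : EuclideanSpace ℝ (Fin d)} (ht : ∀ j, t j ∈ Set.Icc 0 h) :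
    transNorm (stepFn h v) q volume t ≤
      ∑ i, eLpNorm (stepFn h (latticeDiff i v)) q volume := by
  have h1 : t = ∑ i, (t i / h) • h • EuclideanSpace.single i (1 : ℝ) := by
    ext j
    simp [Finset.sum_apply, Pi.single_apply, smul_smul, hh.ne']
  rw [h1]
  refine (transNorm_sum_le (measurable_stepFn h v).aestronglyMeasurable hq _ _).trans
    (Finset.sum_le_sum fun i _ => transNorm_stepFn_smul_le hh v q i ⟨?_, ?_⟩)
  · exact div_nonneg (ht i).1 hh.le
  · exact (div_le_one hh).2 (ht i).2

theorem eLpNorm_avg_sub_le {P : Measure (EuclideanSpace ℝ (Fin d))} [IsProbabilityMeasure P]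
    {h : ℝ} (hh : 0 < h) (hP : ∀ᵐ t ∂P, ∀ j, t j ∈ Set.Icc 0 h) {v : (Fin d → ℤ) → ℂ} {C : ℝ}
    (hC : ∀ x, ‖v x‖ ≤ C) {q : ℝ} (hq : 1 ≤ q) :
    eLpNorm (avg P (stepFn h v) - stepFn h v) (ENNReal.ofReal q) volume ≤
      ∑ i, eLpNorm (stepFn h (latticeDiff i v)) (ENNReal.ofReal q) volume := by
  have hq0 : 0 < q := by linarith
  have hm := measurable_stepFn h v
  rw [← ENNReal.rpow_le_rpow_iff hq0, eLpNorm_ofReal_rpow hq0]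
  have h1 : avg P (stepFn h v) - stepFn h v =
      fun x => ∫ t, (stepFn h v (x + t) - stepFn h v x) ∂P := by
    ext x
    have h2 : Integrable (fun t => stepFn h v (x + t)) P :=
      integrable_of_bounded (hm.comp (measurable_const_add x)) fun t => hC _
    rw [integral_sub h2 (integrable_const _)]
    simp [avg]
  rw [h1, powInt]
  refine (lintegral_enorm_integral_rpow_le P
    (F := fun x t => stepFn h v (x + t) - stepFn h v x) ?_ hq).trans ?_
  · exact ((hm.comp measurable_add).sub (hm.comp measurable_fst)).aestronglyMeasurable
  · calc _ ≤ ∫⁻ t, (∑ i, eLpNorm (stepFn h (latticeDiff i v)) (ENNReal.ofReal q) volume) ^ q ∂P := by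
          refine lintegral_mono_ae (hP.mono fun t ht => ?_)
          refine (transNorm_rpow hq0 (μ := volume) (stepFn h v) t).symm.le.trans ?_
          gcongr
          exact transNorm_stepFn_le hh v (by simpa using hq) ht
      _ = _ := by simp

theorem isWeakGradient_avg_segMeasure {h : ℝ} (hh : 0 < h)
    {u : EuclideanSpace ℝ (Fin d) → ℂ} {w : Fin d → EuclideanSpace ℝ (Fin d) → ℂ}
    (hw : ∀ i, MemLp (w i) 2 volume)
    (hu : ∀ i, u = avg (segMeasure (h • EuclideanSpace.single i 1)) (w i)) :
    IsWeakGradient u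
      (fun i x => h⁻¹ • (w i (x + h • EuclideanSpace.single i 1) - w i x)) := by
  intro φ hφ hφc i
  have h1 := integral_fderiv_smul_avg_segMeasure (hw i) (h • EuclideanSpace.single i (1 : ℝ)) hφ hφc
  rw [← hu i] at h1
  simp_rw [map_smul, smul_assoc] at h1
  rw [integral_smul] at h1
  simp_rw [smul_comm _ h⁻¹]
  rw [integral_smul, ← smul_neg, ← h1, smul_smul, inv_mul_cancel₀ hh.ne', one_smul]

/-- u is the average of the step function over a box of side h. Jensen gives all norm bounds.
Splitting off the edge in direction i writes u as a segment average of w_i, so ∂_i u is the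
difference quotient of w_i, itself an average of the lattice difference quotient. The distance to
the step function is controlled by translations within the box. -/
theorem exists_interpolant {h : ℝ} (hh : 0 < h) {v : (Fin d → ℤ) → ℂ}
    (hv : Summable (fun x => ‖v x‖ ^ 2)) :
    ∃ (u : EuclideanSpace ℝ (Fin d) → ℂ) (g : Fin d → EuclideanSpace ℝ (Fin d) → ℂ), IsH1 u g ∧
      (∀ q : ℝ, 1 ≤ q → powInt q u volume ≤ powInt q (stepFn h v) volume) ∧
      (∀ q : ℝ, 1 ≤ q → eLpNorm (stepFn h v) (ENNReal.ofReal q) volume ≤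
        eLpNorm u (ENNReal.ofReal q) volume +
          ∑ i, eLpNorm (stepFn h (latticeDiff i v)) (ENNReal.ofReal q) volume) ∧
      ∀ i, powInt 2 (g i) volume ≤
        ENNReal.ofReal ((h ^ 2)⁻¹) * powInt 2 (stepFn h (latticeDiff i v)) volume := by
  obtain ⟨P, hP, hQ, hb⟩ := exists_box_measure (d := d) hh Finset.univ
  have hm := measurable_stepFn h v
  have hL2 : MemLp (stepFn h v) 2 volume := by
    rw [memLp_two_iff hm.aestronglyMeasurable, lt_top_iff_ne_top]
    exact powInt_stepFn_two_ne_top hh hv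
  -- Square-summability implies boundedness, which makes all translates integrable for the
  -- probability measures involved.
  obtain ⟨C, hC⟩ : ∃ C, ∀ x, ‖v x‖ ≤ C := ⟨√(∑' x, ‖v x‖ ^ 2), fun x =>
    Real.le_sqrt_of_sq_le (hv.le_tsum x fun _ _ => by positivity)⟩
  choose Q hQp hQ using fun i => hQ i (Finset.mem_univ i)
  have hw : ∀ i, MemLp (avg (Q i) (stepFn h v)) 2 volume := fun i => memLp_avg hL2
  have hw' : ∀ i, MemLp (fun x => avg (Q i) (stepFn h v) (x + h • EuclideanSpace.single i 1)) 2
      volume := fun i => (hw i).comp_measurePreserving (measurePreserving_add_right' _)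
  refine ⟨avg P (stepFn h v), _, ⟨memLp_avg hL2, fun i => ?_,
    isWeakGradient_avg_segMeasure hh hw fun i => ?_⟩, fun q hq => ?_, fun q hq => ?_, fun i => ?_⟩
  · exact ((hw' i).sub (hw i)).const_smul h⁻¹
  · rw [hQ i, avg_conv _ _ hm fun x => hC _]
  · exact lintegral_avg_rpow_le hm.aestronglyMeasurable hq
  · have h1 := eLpNorm_avg_sub_le hh (hb.mono fun t ht j => (ht j).1 (Finset.mem_univ j)) hC hq
    have h2 : stepFn h v = avg P (stepFn h v) - (avg P (stepFn h v) - stepFn h v) := by simp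
    have h3 := eLpNorm_sub_le (p := ENNReal.ofReal q) (memLp_avg (P := P) hL2).1
      ((memLp_avg (P := P) hL2).1.sub hL2.1) (by simpa using hq)
    rw [← h2] at h3
    exact h3.trans (add_le_add le_rfl h1)
  · have h1 : ∀ x, avg (Q i) (stepFn h v) (x + h • EuclideanSpace.single i 1) -
        avg (Q i) (stepFn h v) x = avg (Q i) (stepFn h (latticeDiff i v)) x := fun x => by
      simp only [avg, stepFn_latticeDiff hh]
      rw [← integral_sub]
      · congr 1; ext t; rw [add_right_comm]
      · exact integrable_of_bounded (hm.comp (measurable_const_add _)) fun t => hC _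
      · exact integrable_of_bounded (hm.comp (measurable_const_add _)) fun t => hC _
    simp_rw [h1]
    have h2 : ∀ z : ℂ, ‖h⁻¹ • z‖ₑ ^ (2 : ℝ) = ENNReal.ofReal ((h ^ 2)⁻¹) * ‖z‖ₑ ^ (2 : ℝ) := by
      intro z
      rw [enorm_smul, ENNReal.mul_rpow_of_nonneg _ _ zero_le_two, ← inv_pow,
        ENNReal.ofReal_pow (by positivity), ← ofReal_norm, Real.norm_of_nonneg (by positivity)]
      norm_cast
    simp only [powInt, h2]
    rw [lintegral_const_mul' _ _ ENNReal.ofReal_ne_top]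
    exact mul_le_mul' le_rfl (lintegral_avg_rpow_le
      (measurable_stepFn h _).aestronglyMeasurable one_le_two)

end

section

/-! ### Discretization by cell averages -/

variable {d : ℕ}

/-- The average of `v` over the cells of side `h`. -/
def cellAvg (h : ℝ) (v : EuclideanSpace ℝ (Fin d) → ℂ) (k : Fin d → ℤ) : ℂ :=
  ⨍ y in cellIndex h ⁻¹' {k}, v y

theorem measurableSet_cell (h : ℝ) (k : Fin d → ℤ) :
    MeasurableSet (cellIndex h ⁻¹' {k} : Set (EuclideanSpace ℝ (Fin d))) :=
  measurable_cellIndex h (MeasurableSet.singleton k)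

theorem cell_ne_zero {h : ℝ} (hh : 0 < h) (k : Fin d → ℤ) :
    volume (cellIndex h ⁻¹' {k} : Set (EuclideanSpace ℝ (Fin d))) ≠ 0 := by
  rw [volume_cellIndex_preimage hh]
  simp only [ne_eq, ENNReal.ofReal_eq_zero, not_le]
  positivity

theorem cell_ne_top {h : ℝ} (hh : 0 < h) (k : Fin d → ℤ) :
    volume (cellIndex h ⁻¹' {k} : Set (EuclideanSpace ℝ (Fin d))) ≠ ⊤ := by
  rw [volume_cellIndex_preimage hh]
  simp

/-- Jensen on each cell, then summation over the partition of space into cells. -/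
theorem powInt_cellAvg_le {h : ℝ} (hh : 0 < h) {q : ℝ} (hq : 1 ≤ q)
    (v : EuclideanSpace ℝ (Fin d) → ℂ) :
    powInt q (stepFn h (cellAvg h v)) volume ≤ powInt q v volume := by
  have h0 : ENNReal.ofReal (h ^ d) ≠ 0 := by
    simp only [ne_eq, ENNReal.ofReal_eq_zero, not_le]; positivity
  have h1 : ∀ k, ‖cellAvg h v k‖ₑ ^ q ≤
      (ENNReal.ofReal (h ^ d))⁻¹ * ∫⁻ y in cellIndex h ⁻¹' {k}, ‖v y‖ₑ ^ q := by
    intro k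
    have : NeZero (volume.restrict (cellIndex h ⁻¹' {k} : Set (EuclideanSpace ℝ (Fin d)))) :=
      ⟨by simpa using cell_ne_zero hh k⟩
    have : IsFiniteMeasure
        (volume.restrict (cellIndex h ⁻¹' {k} : Set (EuclideanSpace ℝ (Fin d)))) :=
      ⟨by simpa using (cell_ne_top hh k).lt_top⟩
    refine (enorm_integral_rpow_le _ _ hq).trans ?_
    rw [lintegral_smul_measure, Measure.restrict_apply_univ, volume_cellIndex_preimage hh,
      smul_eq_mul]
  rw [powInt_stepFn hh, powInt, lintegral_count, ← ENNReal.tsum_mul_left]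
  calc _ ≤ ∑' k, ∫⁻ y in cellIndex h ⁻¹' {k}, ‖v y‖ₑ ^ q := by
        refine ENNReal.tsum_le_tsum fun k => ?_
        calc _ ≤ ENNReal.ofReal (h ^ d) * _ := mul_le_mul' le_rfl (h1 k)
          _ = _ := by rw [← mul_assoc, ENNReal.mul_inv_cancel h0 ENNReal.ofReal_ne_top, one_mul]
    _ = powInt q v volume := by
        rw [← lintegral_iUnion (measurableSet_cell h) (pairwise_disjoint_fiber _), powInt,
          ← Set.preimage_iUnion, Set.iUnion_of_singleton, Set.preimage_univ, setLIntegral_univ]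

theorem integrableOn_cell {h : ℝ} (hh : 0 < h) {v : EuclideanSpace ℝ (Fin d) → ℂ}
    (hv : MemLp v 2 volume) (k : Fin d → ℤ) : IntegrableOn v (cellIndex h ⁻¹' {k}) volume := by
  have : IsFiniteMeasure
      (volume.restrict (cellIndex h ⁻¹' {k} : Set (EuclideanSpace ℝ (Fin d)))) :=
    ⟨by simpa using (cell_ne_top hh k).lt_top⟩
  exact (hv.restrict _).integrable one_le_two

theorem latticeDiff_cellAvg {h : ℝ} (hh : 0 < h) {v : EuclideanSpace ℝ (Fin d) → ℂ}
    (hv : MemLp v 2 volume) (i : Fin d) :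
    latticeDiff i (cellAvg h v) =
      cellAvg h (fun x => v (x + h • EuclideanSpace.single i 1) - v x) := by
  ext k
  set e : EuclideanSpace ℝ (Fin d) := h • EuclideanSpace.single i (1 : ℝ) with he
  have hmp := measurePreserving_add_right' (μ := (volume : Measure (EuclideanSpace ℝ (Fin d)))) e
  have hv' : MemLp (fun x => v (x + e)) 2 volume := hv.comp_measurePreserving hmp
  have h1 : (fun x => x + e) ⁻¹' (cellIndex h ⁻¹' {k + Pi.single i 1}) =
      (cellIndex h ⁻¹' {k} : Set (EuclideanSpace ℝ (Fin d))) := by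
    ext x
    simp [he, cellIndex_add h hh]
  have h2 := hmp.setIntegral_preimage_emb (measurableEmbedding_addRight e) v
    (cellIndex h ⁻¹' {k + Pi.single i 1})
  rw [h1] at h2
  simp only [latticeDiff, cellAvg, setAverage_eq, Measure.real, volume_cellIndex_preimage hh]
  rw [integral_sub (integrableOn_cell hh hv' k) (integrableOn_cell hh hv k), h2, smul_sub]

/-- In the sup norm a cell is a ball up to a null set, so Lebesgue differentiation over balls
applies. -/
theorem cellAvg_eq_average_closedBall {h : ℝ} (hh : 0 < h) (v : EuclideanSpace ℝ (Fin d) → ℂ)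
    (k : Fin d → ℤ) :
    cellAvg h v k =
      ⨍ y in Metric.closedBall (fun i => (k i + 1 / 2) * h : Fin d → ℝ) (h / 2),
        v (WithLp.toLp 2 y) := by
  have h1 : Metric.closedBall (fun i => (k i + 1 / 2) * h : Fin d → ℝ) (h / 2) =
      Set.univ.pi fun i => Set.Icc (k i * h) ((k i + 1) * h) := by
    rw [closedBall_pi _ (by positivity)]
    congr 1; ext i : 1
    rw [Real.closedBall_eq_Icc]
    congr 1 <;> ring
  have h2 : (Set.univ.pi fun i => Set.Ico (k i * h) ((k i + 1) * h)) =ᵐ[volume]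
      (Set.univ.pi fun i => Set.Icc (k i * h) ((k i + 1) * h) : Set (Fin d → ℝ)) := by
    rw [Set.pi_univ_Icc]
    exact Measure.univ_pi_Ico_ae_eq_Icc
  rw [h1, ← setAverage_congr h2]
  have h3 := (PiLp.volume_preserving_ofLp (Fin d)).setIntegral_preimage_emb
    (MeasurableEquiv.toLp 2 (Fin d → ℝ)).symm.measurableEmbedding (fun y => v (WithLp.toLp 2 y))
    (Set.univ.pi fun i => Set.Ico (k i * h) ((k i + 1) * h))
  rw [cellAvg, setAverage_eq, setAverage_eq, ← h3, ofLp_image_cellIndex_preimage hh]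
  simp only [Measure.real]
  rw [(PiLp.volume_preserving_ofLp (Fin d)).measure_preimage
    (MeasurableSet.univ_pi fun i => measurableSet_Ico).nullMeasurableSet]

theorem mem_closedBall_cellIndex {h : ℝ} (hh : 0 < h) (x : EuclideanSpace ℝ (Fin d)) :
    WithLp.ofLp x ∈
      Metric.closedBall (fun i => (cellIndex h x i + 1 / 2) * h : Fin d → ℝ) (h / 2) := by
  rw [closedBall_pi _ (by positivity)]
  intro i _
  simp only [Real.closedBall_eq_Icc]
  have h1 := (le_div_iff₀ hh).1 (Int.floor_le (x i / h))
  have h2 := (div_lt_iff₀ hh).1 (Int.lt_floor_add_one (x i / h))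
  constructor <;> simp only [cellIndex] <;> nlinarith

/-- The cell containing x is not centred at x, so the differentiation theorem is used in its version
with moving centres; the ratio 1 suffices since x lies in the closed cell. -/
theorem ae_tendsto_cellAvg {v : EuclideanSpace ℝ (Fin d) → ℂ}
    (hv : LocallyIntegrable v volume) :
    ∀ᵐ x, Tendsto (fun h => stepFn h (cellAvg h v) x) (𝓝[>] 0) (𝓝 (v x)) := by
  have hv' : LocallyIntegrable (fun y : Fin d → ℝ => v (WithLp.toLp 2 y)) volume := by
    rw [locallyIntegrable_iff] at hv ⊢
    intro K hK
    have h1 := hv (WithLp.toLp 2 '' K) (hK.image (PiLp.continuous_toLp 2 _))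
    exact ((PiLp.volume_preserving_toLp (Fin d)).integrableOn_image
      (MeasurableEquiv.toLp 2 (Fin d → ℝ)).measurableEmbedding).1 h1
  have h1 := IsUnifLocDoublingMeasure.ae_tendsto_average (μ := volume) hv' 1
  have h2 := (PiLp.volume_preserving_ofLp (Fin d)).quasiMeasurePreserving.ae h1
  filter_upwards [h2] with x hx
  have h3 : Tendsto (fun h : ℝ => h / 2) (𝓝[>] 0) (𝓝[>] 0) := by
    refine tendsto_nhdsWithin_iff.2 ⟨?_, ?_⟩
    · have : Tendsto (fun h : ℝ => h / 2) (𝓝 0) (𝓝 (0 / 2)) := tendsto_id.div_const 2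
      rw [zero_div] at this
      exact this.mono_left nhdsWithin_le_nhds
    · filter_upwards [self_mem_nhdsWithin] with h hh
      exact Set.mem_Ioi.2 (half_pos (Set.mem_Ioi.1 hh))
  have h4 := hx (fun h => fun i => (cellIndex h x i + 1 / 2) * h) (fun h => h / 2) h3
    (by
      filter_upwards [self_mem_nhdsWithin] with h hh
      simpa using mem_closedBall_cellIndex hh x)
  refine h4.congr' ?_
  filter_upwards [self_mem_nhdsWithin] with h hh
  exact (cellAvg_eq_average_closedBall hh v _).symm

/-- Fatou's lemma along the a.e. convergence of cell averages. With Jensen's opposite inequality it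
gives convergence of mass and of the L^{p+1} integral. -/
theorem powInt_le_liminf_cellAvg {v : EuclideanSpace ℝ (Fin d) → ℂ}
    (hv : LocallyIntegrable v volume) (q : ℝ) :
    powInt q v volume ≤ liminf (fun h => powInt q (stepFn h (cellAvg h v)) volume) (𝓝[>] 0) := by
  refine le_trans ?_ (lintegral_liminf_le fun h =>
    (measurable_stepFn h (cellAvg h v)).enorm.pow_const q)
  refine lintegral_mono_ae ((ae_tendsto_cellAvg hv).mono fun x hx => ?_)
  exact (((ENNReal.continuous_rpow_const.tendsto _).comp
    ((continuous_enorm.tendsto _).comp hx)).liminf_eq).ge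

theorem summable_cellAvg {h : ℝ} (hh : 0 < h) {v : EuclideanSpace ℝ (Fin d) → ℂ}
    (hv : MemLp v 2 volume) : Summable (fun x => ‖cellAvg h v x‖ ^ 2) := by
  have h1 : powInt 2 (stepFn h (cellAvg h v)) volume < ⊤ :=
    (powInt_cellAvg_le hh one_le_two v).trans_lt ((memLp_two_iff hv.1).1 hv)
  rw [powInt_stepFn hh] at h1
  have h0 : ENNReal.ofReal (h ^ d) ≠ 0 := by
    simp only [ne_eq, ENNReal.ofReal_eq_zero, not_le]; positivity
  have h2 : powInt 2 (cellAvg h v) Measure.count ≠ ⊤ := fun H => by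
    rw [H, ENNReal.mul_top h0] at h1
    exact lt_irrefl _ h1
  rw [powInt_count_ne_top_iff zero_le_two] at h2
  exact_mod_cast h2

/-- The Dirichlet integral `∫ |∇v|²`, where `g = ∇v`. -/
def kin (g : Fin d → EuclideanSpace ℝ (Fin d) → ℂ) : ℝ := ∑ i, (powInt 2 (g i) volume).toReal

/-- Differences of cell averages are cell averages of v(x + h e_i) - v(x). Jensen removes the
averaging, and the increment is h times an average of ∂_i v. -/
theorem IsH1.latticeKin_cellAvg_le {h : ℝ} (hh : 0 < h) {v : EuclideanSpace ℝ (Fin d) → ℂ}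
    {g : Fin d → EuclideanSpace ℝ (Fin d) → ℂ} (hv : IsH1 v g) :
    latticeKin h (cellAvg h v) ≤ kin g := by
  refine Finset.sum_le_sum fun i _ => ?_
  rw [div_le_iff₀ (by positivity), latticeDiff_cellAvg hh hv.memLp]
  have h1 := (powInt_cellAvg_le hh one_le_two _).trans (hv.lintegral_sub_translate_le h i)
  have h2 : powInt 2 (g i) volume ≠ ⊤ :=
    ((memLp_two_iff (hv.memLp_grad i).1).1 (hv.memLp_grad i)).ne
  have h3 := ENNReal.toReal_mono (ENNReal.mul_ne_top ENNReal.ofReal_ne_top h2) h1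
  rw [ENNReal.toReal_mul, ENNReal.toReal_ofReal (by positivity)] at h3
  linarith

theorem eventually_powInt_cellAvg_ge {v : EuclideanSpace ℝ (Fin d) → ℂ}
    (hv : MemLp v 2 volume) {q : ℝ} (hq : 1 ≤ q) (hfin : powInt q v volume ≠ ⊤) {ε : ℝ}
    (hε : 0 < ε) : ∀ᶠ h in 𝓝[>] (0 : ℝ), (powInt q v volume).toReal - ε ≤
      (powInt q (stepFn h (cellAvg h v)) volume).toReal := by
  have h1 := powInt_le_liminf_cellAvg (hv.locallyIntegrable one_le_two) q
  rcases eq_or_ne (powInt q v volume) 0 with h0 | h0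
  · refine Eventually.of_forall fun h => ?_
    rw [h0, ENNReal.toReal_zero]
    linarith [ENNReal.toReal_nonneg (a := powInt q (stepFn h (cellAvg h v)) volume)]
  · have h2 : powInt q v volume - ENNReal.ofReal ε <
        liminf (fun h => powInt q (stepFn h (cellAvg h v)) volume) (𝓝[>] 0) :=
      (ENNReal.sub_lt_self hfin h0 (by simpa using hε)).trans_le h1
    filter_upwards [eventually_lt_of_lt_liminf h2, self_mem_nhdsWithin] with h h3 hh
    have h4 := tsub_le_iff_right.1 h3.le
    have h5 : powInt q (stepFn h (cellAvg h v)) volume ≠ ⊤ :=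
      ne_top_of_le_ne_top hfin (powInt_cellAvg_le hh hq v)
    have h6 := ENNReal.toReal_mono (ENNReal.add_ne_top.2 ⟨h5, ENNReal.ofReal_ne_top⟩) h4
    rw [ENNReal.toReal_add h5 ENNReal.ofReal_ne_top, ENNReal.toReal_ofReal hε.le] at h6
    linarith

theorem eventually_latticeMass_cellAvg {v : EuclideanSpace ℝ (Fin d) → ℂ}
    (hv : MemLp v 2 volume) {ε : ℝ} (hε : 0 < ε) : ∀ᶠ h in 𝓝[>] (0 : ℝ),
      mass v - ε ≤ latticeMass h (cellAvg h v) ∧ latticeMass h (cellAvg h v) ≤ mass v := by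
  have hfin : powInt 2 v volume ≠ ⊤ := ((memLp_two_iff hv.1).1 hv).ne
  filter_upwards [eventually_powInt_cellAvg_ge hv one_le_two hfin hε, self_mem_nhdsWithin]
    with h h1 hh
  rw [mass_eq hv.1, latticeMass_eq hh]
  exact ⟨h1, ENNReal.toReal_mono hfin (powInt_cellAvg_le hh one_le_two v)⟩

end

section

/-! ### Bounds from below -/

variable {d : ℕ} {p : ℝ}

theorem exists_powInt_stepFn_bound (hd : 1 ≤ d) (hp1 : 1 < p) (hp2 : p < 1 + 4 / d) (m₁ : ℝ) :
    ∃ C : ℝ, 0 ≤ C ∧ ∀ (h : ℝ) (v : (Fin d → ℤ) → ℂ), 0 < h → Summable (fun x => ‖v x‖ ^ 2) →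
      latticeMass h v ≤ m₁ → powInt (p + 1) (stepFn h v) volume ≠ ⊤ ∧
        (powInt (p + 1) (stepFn h v) volume).toReal ≤ C + 1 / 4 * latticeKin h v := by
  set G := gnConst d (p + 1) * (max m₁ 0) ^ (2 / d : ℝ) with hG
  have hG0 : 0 ≤ G := by have := gnConst_nonneg d (p + 1); positivity
  -- The exponent p - 1 - 4/d is negative, so a large threshold L makes the coefficient of the
  -- Dirichlet energy at most 1/4, uniformly in h.
  have hlim : Tendsto (fun L : ℝ => G * L ^ (p + 1 - 2 - 4 / d)) atTop (𝓝 (G * 0)) := by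
    have := tendsto_rpow_neg_atTop (y := 1 + 4 / d - p) (by linarith)
    refine Tendsto.const_mul _ (this.congr fun L => ?_)
    congr 1; ring
  rw [mul_zero] at hlim
  obtain ⟨L, hL1, hL⟩ := ((hlim.eventually (gt_mem_nhds (by norm_num : (0 : ℝ) < 1 / 4))).and
    (eventually_gt_atTop 0)).exists
  refine ⟨L ^ (p + 1 - 2) * max m₁ 0, by positivity, fun h v hh hv hm => ?_⟩
  have h1 := powInt_stepFn_le hd (by linarith : 2 < p + 1) (by linarith) hL hh hv
  have hK0 : 0 ≤ latticeKin h v := Finset.sum_nonneg fun i _ => by positivity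
  have hM0 : 0 ≤ latticeMass h v := by rw [latticeMass_eq hh]; positivity
  have hC := gnConst_nonneg d (p + 1)
  refine ⟨ne_top_of_le_ne_top ENNReal.ofReal_ne_top h1, ?_⟩
  refine (ENNReal.toReal_le_of_le_ofReal (by positivity) h1).trans ?_
  have hm' : latticeMass h v ≤ max m₁ 0 := hm.trans (le_max_left _ _)
  have h2 : gnConst d (p + 1) * latticeMass h v ^ (2 / d : ℝ) ≤ G := by
    rw [hG]; gcongr
  have h3 : gnConst d (p + 1) * latticeMass h v ^ (2 / d : ℝ) * L ^ (p + 1 - 2 - 4 / d) ≤ 1 / 4 :=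
    (by gcongr : _ ≤ G * L ^ (p + 1 - 2 - 4 / d)).trans hL1.le
  exact add_le_add (by gcongr) (by gcongr)

theorem le_latticeEnergy (hd : 1 ≤ d) (hp1 : 1 < p) (hp2 : p < 1 + 4 / d) (m₁ : ℝ) :
    ∃ C : ℝ, 0 ≤ C ∧ ∀ (h : ℝ) (v : (Fin d → ℤ) → ℂ), 0 < h → Summable (fun x => ‖v x‖ ^ 2) →
      latticeMass h v ≤ m₁ → 1 / 4 * latticeKin h v - C ≤ latticeEnergy p h v := by
  obtain ⟨C, hC0, hC⟩ := exists_powInt_stepFn_bound hd hp1 hp2 m₁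
  refine ⟨C, hC0, fun h v hh hv hm => ?_⟩
  rw [latticeEnergy_eq hh (by linarith) hv]
  have h1 := (hC h v hh hv hm).2
  have hK0 : 0 ≤ latticeKin h v := Finset.sum_nonneg fun i _ => by positivity
  have h2 : 1 / (p + 1) * (powInt (p + 1) (stepFn h v) volume).toReal ≤
      1 * (powInt (p + 1) (stepFn h v) volume).toReal := by
    gcongr
    rw [div_le_one (by linarith)]; linarith
  linarith

theorem IsH1.energy_eq {v : EuclideanSpace ℝ (Fin d) → ℂ}
    {g : Fin d → EuclideanSpace ℝ (Fin d) → ℂ} (hv : IsH1 v g) (hp : 0 ≤ p + 1) :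
    energy p v g = 1 / 2 * kin g - 1 / (p + 1) * (powInt (p + 1) v volume).toReal :=
  NLS.energy_eq hp hv.memLp.1 hv.memLp_grad

/-- The continuum bound is inherited from the lattice: one sufficiently small h and the cell
averages of v are enough. The extra 1 pays for the loss in the L^{p+1} integral. -/
theorem le_energy (hd : 1 ≤ d) (hp1 : 1 < p) (hp2 : p < 1 + 4 / d) (m : ℝ) :
    ∃ C : ℝ, ∀ (v : EuclideanSpace ℝ (Fin d) → ℂ) (g : Fin d → EuclideanSpace ℝ (Fin d) → ℂ),
      IsH1 v g → Integrable (fun x => ‖v x‖ ^ (p + 1)) → mass v ≤ m → -C ≤ energy p v g := by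
  obtain ⟨C, hC0, hC⟩ := exists_powInt_stepFn_bound hd hp1 hp2 m
  refine ⟨C + 1, fun v g hv hint hm => ?_⟩
  have hfin := (powInt_ne_top_iff hv.memLp.1 (by linarith : 0 ≤ p + 1)).2 hint
  obtain ⟨h, ⟨h1, h2⟩, hh⟩ := (((eventually_powInt_cellAvg_ge hv.memLp (by linarith : 1 ≤ p + 1)
    hfin one_pos).and (eventually_latticeMass_cellAvg hv.memLp one_pos)).and
    self_mem_nhdsWithin).exists
  have h3 := (hC h _ hh (summable_cellAvg hh hv.memLp) (h2.2.trans hm)).2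
  have h4 := hv.latticeKin_cellAvg_le (Set.mem_Ioi.1 hh)
  have hk : 0 ≤ kin g := Finset.sum_nonneg fun i _ => by positivity
  rw [hv.energy_eq (by linarith)]
  have h5 : 1 / (p + 1) * (powInt (p + 1) v volume).toReal ≤
      1 * (powInt (p + 1) v volume).toReal := by
    gcongr
    rw [div_le_one (by linarith)]; linarith
  linarith

theorem bddBelow_energySet (hd : 1 ≤ d) (hp1 : 1 < p) (hp2 : p < 1 + 4 / d) (m : ℝ) :
    BddBelow (energySet d p m) := by
  obtain ⟨C, hC⟩ := le_energy hd hp1 hp2 m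
  exact ⟨-C, by rintro _ ⟨v, g, hv, hint, hm, rfl⟩; exact hC v g hv hint hm.le⟩

/-! ### Scaling and monotonicity of the minimum energy -/

theorem IsH1.const_mul {v : EuclideanSpace ℝ (Fin d) → ℂ}
    {g : Fin d → EuclideanSpace ℝ (Fin d) → ℂ} (hv : IsH1 v g) (c : ℂ) :
    IsH1 (fun x => c * v x) (fun i x => c * g i x) := by
  refine ⟨hv.memLp.const_mul c, fun i => (hv.memLp_grad i).const_mul c, fun φ hφ hφc i => ?_⟩
  have h1 := hv.weakGradient φ hφ hφc i
  have h2 : ∀ (a : ℝ) (z : ℂ), a • (c * z) = c * a • z := fun a z => (mul_smul_comm a c z).symm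
  simp only [h2]
  rw [integral_const_mul, integral_const_mul, h1, mul_neg]

theorem mass_const_mul (v : EuclideanSpace ℝ (Fin d) → ℂ) (c : ℂ) :
    mass (fun x => c * v x) = ‖c‖ ^ 2 * mass v := by
  simp only [mass, norm_mul, mul_pow]
  exact integral_const_mul _ _

theorem energy_const_mul (v : EuclideanSpace ℝ (Fin d) → ℂ)
    (g : Fin d → EuclideanSpace ℝ (Fin d) → ℂ) (c : ℂ) :
    energy p (fun x => c * v x) (fun i x => c * g i x) =
      ‖c‖ ^ 2 * (1 / 2 * ∫ x, ∑ i, ‖g i x‖ ^ 2) -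
        ‖c‖ ^ (p + 1) * (1 / (p + 1) * ∫ x, ‖v x‖ ^ (p + 1)) := by
  simp_rw [energy, norm_mul, mul_pow, ← Finset.mul_sum, integral_const_mul,
    Real.mul_rpow (norm_nonneg _) (norm_nonneg _), integral_const_mul]
  ring

/-- Under amplification the negative term grows like ‖c‖^{p+1}, faster than the kinetic ‖c‖². -/
theorem energy_const_mul_le (hp1 : 1 < p) (v : EuclideanSpace ℝ (Fin d) → ℂ)
    (g : Fin d → EuclideanSpace ℝ (Fin d) → ℂ) {c : ℂ} (hc : 1 ≤ ‖c‖) :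
    energy p (fun x => c * v x) (fun i x => c * g i x) ≤ ‖c‖ ^ 2 * energy p v g := by
  have h1 : 0 ≤ ∫ x, ‖v x‖ ^ (p + 1) := integral_nonneg fun x => by positivity
  have h2 : 0 ≤ 1 / (p + 1) * ∫ x, ‖v x‖ ^ (p + 1) :=
    mul_nonneg (one_div_nonneg.2 (by linarith)) h1
  have h3 : ‖c‖ ^ 2 ≤ ‖c‖ ^ (p + 1) := by
    rw [← Real.rpow_natCast]
    exact Real.rpow_le_rpow_of_exponent_le hc (by push_cast; linarith)
  rw [energy_const_mul, energy, mul_sub]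
  have := mul_le_mul_of_nonneg_right h3 h2
  linarith

theorem integrable_const_mul_rpow {v : EuclideanSpace ℝ (Fin d) → ℂ}
    (hint : Integrable (fun x => ‖v x‖ ^ (p + 1))) (c : ℂ) :
    Integrable (fun x => ‖c * v x‖ ^ (p + 1)) := by
  simp_rw [norm_mul, Real.mul_rpow (norm_nonneg _) (norm_nonneg _)]
  exact hint.const_mul _

theorem Emin_le_mul_energy (hd : 1 ≤ d) (hp1 : 1 < p) (hp2 : p < 1 + 4 / d)
    {v : EuclideanSpace ℝ (Fin d) → ℂ} {g : Fin d → EuclideanSpace ℝ (Fin d) → ℂ} (hv : IsH1 v g)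
    (hint : Integrable (fun x => ‖v x‖ ^ (p + 1))) (hm0 : 0 < mass v) {m : ℝ} (hm : mass v ≤ m) :
    Emin d p m ≤ m / mass v * energy p v g := by
  have hr : 1 ≤ m / mass v := by rwa [one_le_div hm0]
  have hc : ‖((√(m / mass v) : ℝ) : ℂ)‖ = √(m / mass v) := by
    rw [Complex.norm_real, Real.norm_of_nonneg (Real.sqrt_nonneg _)]
  have hc2 : ‖((√(m / mass v) : ℝ) : ℂ)‖ ^ 2 = m / mass v := by
    rw [hc, Real.sq_sqrt (by linarith)]
  have h1 := energy_const_mul_le hp1 v g (c := ((√(m / mass v) : ℝ) : ℂ))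
    (by rw [hc]; exact Real.one_le_sqrt.2 hr)
  rw [hc2] at h1
  refine (csInf_le (bddBelow_energySet hd hp1 hp2 m) ⟨_, _, hv.const_mul _,
    integrable_const_mul_rpow hint _, ?_, rfl⟩).trans h1
  rw [mass_const_mul, hc2, div_mul_cancel₀ _ hm0.ne']

/-! ### The minimum energy is negative -/

theorem isH1_of_contDiff {f : EuclideanSpace ℝ (Fin d) → ℂ} (hf : ContDiff ℝ ∞ f)
    (hfc : HasCompactSupport f) :
    IsH1 f (fun i x => fderiv ℝ f x (EuclideanSpace.single i 1)) := by
  have hd' : ∀ i : Fin d, Continuous (fun x => fderiv ℝ f x (EuclideanSpace.single i 1)) :=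
    fun i => (hf.continuous_fderiv (by simp)).clm_apply continuous_const
  have hdc : ∀ i : Fin d, HasCompactSupport (fun x => fderiv ℝ f x (EuclideanSpace.single i 1)) :=
    fun i => hfc.fderiv_apply (𝕜 := ℝ) _
  refine ⟨hf.continuous.memLp_of_hasCompactSupport hfc,
    fun i => (hd' i).memLp_of_hasCompactSupport (hdc i), fun φ hφ hφc i => ?_⟩
  rw [integral_smul_fderiv_eq_neg_fderiv_smul_of_integrable, neg_neg]
  · exact (((hφ.continuous_fderiv (by simp)).clm_apply continuous_const).smul
      hf.continuous).integrable_of_hasCompactSupport (hfc.smul_left)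
  · exact (hφ.continuous.smul (hd' i)).integrable_of_hasCompactSupport ((hdc i).smul_left)
  · exact (hφ.continuous.smul hf.continuous).integrable_of_hasCompactSupport (hfc.smul_left)
  · exact fun x _ => hφ.differentiable (by simp) x
  · exact fun x _ => hf.differentiable (by simp) x

theorem integrable_norm_rpow_of_hasCompactSupport {f : EuclideanSpace ℝ (Fin d) → ℂ}
    (hf : Continuous f) (hfc : HasCompactSupport f) {q : ℝ} (hq : 0 < q) :
    Integrable (fun x => ‖f x‖ ^ q) :=
  (hf.norm.rpow_const fun _ => Or.inr hq.le).integrable_of_hasCompactSupport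
    (hfc.comp_left (g := fun z : ℂ => ‖z‖ ^ q) (by simp [hq.ne']))

theorem isH1_dilate {f : EuclideanSpace ℝ (Fin d) → ℂ} (hf : ContDiff ℝ ∞ f)
    (hfc : HasCompactSupport f) {l : ℝ} (hl : 0 < l) :
    IsH1 (fun x => f (l • x)) (fun i x => l • fderiv ℝ f (l • x) (EuclideanSpace.single i 1)) := by
  have h1 : ContDiff ℝ ∞ (fun x => f (l • x)) := hf.comp (contDiff_const_smul l)
  have h2 : HasCompactSupport (fun x => f (l • x)) :=
    hfc.comp_homeomorph (Homeomorph.smulOfNeZero l hl.ne')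
  convert isH1_of_contDiff h1 h2 using 3 with i x
  have h3 : HasFDerivAt (fun x => f (l • x))
      ((fderiv ℝ f (l • x)).comp (l • ContinuousLinearMap.id ℝ (EuclideanSpace ℝ (Fin d)))) x :=
    ((hf.differentiable (by simp)) (l • x)).hasFDerivAt.comp x
      ((hasFDerivAt_id x).const_smul l)
  rw [h3.fderiv]
  simp

theorem exists_contDiff_integral_norm_rpow_pos (d : ℕ) :
    ∃ f : EuclideanSpace ℝ (Fin d) → ℂ, ContDiff ℝ ∞ f ∧ HasCompactSupport f ∧
      ∀ q : ℝ, 0 < q → 0 < ∫ x, ‖f x‖ ^ q := by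
  let ρ : ContDiffBump (0 : EuclideanSpace ℝ (Fin d)) := ⟨1, 2, one_pos, one_lt_two⟩
  have hf : ContDiff ℝ ∞ (fun x => (ρ x : ℂ)) := Complex.ofRealCLM.contDiff.comp ρ.contDiff
  have hfc : HasCompactSupport (fun x => (ρ x : ℂ)) :=
    ρ.hasCompactSupport.comp_left (g := fun t : ℝ => (t : ℂ)) rfl
  refine ⟨_, hf, hfc, fun q hq => ?_⟩
  refine integral_pos_of_integrable_nonneg_nonzero (x := 0)
    (hf.continuous.norm.rpow_const fun x => Or.inr hq.le)
    (integrable_norm_rpow_of_hasCompactSupport hf.continuous hfc hq) (fun x => by positivity) ?_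
  have : ρ 0 = 1 := ρ.one_of_mem_closedBall (by simp [ρ])
  simp [this]

theorem exists_rpow_mul_lt {e a b : ℝ} (he : 0 < e) (hb : 0 < b) :
    ∃ l : ℝ, 0 < l ∧ l ^ e * a < b := by
  have hlim : Tendsto (fun l : ℝ => l ^ e * a) (𝓝[>] 0) (𝓝 (0 * a)) := by
    refine Tendsto.mul_const _ ?_
    have := (Real.continuousAt_rpow_const 0 e (Or.inr he.le)).tendsto
    rw [Real.zero_rpow he.ne'] at this
    exact this.mono_left nhdsWithin_le_nhds
  rw [zero_mul] at hlim
  obtain ⟨l, hl1, hl⟩ := ((hlim.eventually (gt_mem_nhds hb)).and self_mem_nhdsWithin).exists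
  exact ⟨l, hl, hl1⟩

/-- The function c f(l x) with c² = r l^d has mass r M(f), kinetic energy of order l² and potential
energy of order l^{d(p-1)/2}. Factoring out the latter power leaves the hypothesis, which holds for
small l since d(p-1)/2 < 2. -/
theorem dilated_energy_neg {A B r l : ℝ} (hr : 0 < r) (hl : 0 < l)
    (h : l ^ (2 - d * (p - 1) / 2 : ℝ) * (r * (1 / 2 * A)) <
      r ^ ((p + 1) / 2) * (1 / (p + 1) * B)) :
    √(r * l ^ d) ^ 2 * (1 / 2 * (l ^ 2 * ((l ^ d)⁻¹ * A))) -
      √(r * l ^ d) ^ (p + 1) * (1 / (p + 1) * ((l ^ d)⁻¹ * B)) < 0 := by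
  have hcq : √(r * l ^ d) ^ (p + 1) = r ^ ((p + 1) / 2) * (l ^ (d * (p - 1) / 2 : ℝ) * l ^ d) := by
    rw [Real.sqrt_eq_rpow, ← Real.rpow_mul (by positivity),
      Real.mul_rpow (by positivity) (by positivity), ← Real.rpow_natCast l d, ← Real.rpow_mul hl.le,
      ← Real.rpow_add hl]
    ring_nf
  have h3 : l ^ 2 = l ^ (d * (p - 1) / 2 : ℝ) * l ^ (2 - d * (p - 1) / 2 : ℝ) := by
    rw [← Real.rpow_add hl, ← Real.rpow_natCast]; norm_num
  have h4 : 0 < l ^ (d * (p - 1) / 2 : ℝ) := by positivity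
  have h6 : l ^ d * (l ^ d)⁻¹ = 1 := mul_inv_cancel₀ (by positivity)
  rw [Real.sq_sqrt (by positivity), hcq, h3]
  generalize l ^ (d * (p - 1) / 2 : ℝ) = s at *
  generalize l ^ (2 - d * (p - 1) / 2 : ℝ) = t at *
  generalize r ^ ((p + 1) / 2) = w at *
  have h5 : r * l ^ d * (1 / 2 * (s * t * ((l ^ d)⁻¹ * A))) -
      w * (s * l ^ d) * (1 / (p + 1) * ((l ^ d)⁻¹ * B)) =
      s * (t * (r * (1 / 2 * A)) - w * (1 / (p + 1) * B)) := by
    linear_combination (r * (1 / 2 * (s * t * A)) - w * s * (1 / (p + 1) * B)) * h6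
  rw [h5]
  exact mul_neg_of_pos_of_neg h4 (by linarith)

theorem integral_comp_smul_pos (F : EuclideanSpace ℝ (Fin d) → ℝ) {l : ℝ} (hl : 0 < l) :
    ∫ x, F (l • x) = (l ^ d)⁻¹ * ∫ x, F x := by
  rw [Measure.integral_comp_smul]
  simp [abs_of_pos hl]

theorem Emin_neg (hd : 1 ≤ d) (hp1 : 1 < p) (hp2 : p < 1 + 4 / d) {m : ℝ} (hm : 0 < m) :
    Emin d p m < 0 := by
  have hd0 : (0 : ℝ) < d := by exact_mod_cast hd
  obtain ⟨f, hf, hfc, hpow⟩ := exists_contDiff_integral_norm_rpow_pos d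
  have hB0 : 0 < ∫ x, ‖f x‖ ^ (p + 1) := hpow _ (by linarith)
  have hM0 : 0 < mass f := by
    have := hpow 2 two_pos
    rw [mass]
    exact_mod_cast this
  have hexp : 0 < 2 - d * (p - 1) / 2 := by
    have : p - 1 < 4 / d := by linarith
    rw [lt_div_iff₀ hd0] at this
    linarith
  have hpos : 0 < (m / mass f) ^ ((p + 1) / 2) * (1 / (p + 1) * ∫ x, ‖f x‖ ^ (p + 1)) := by
    have : 0 < 1 / (p + 1) := one_div_pos.2 (by linarith)
    positivity
  obtain ⟨l, hl0, hl1⟩ := exists_rpow_mul_lt (a := m / mass f *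
    (1 / 2 * ∫ x, ∑ i, ‖fderiv ℝ f x (EuclideanSpace.single i 1)‖ ^ 2)) hexp hpos
  have hint : Integrable (fun x => ‖f (l • x)‖ ^ (p + 1)) :=
    integrable_norm_rpow_of_hasCompactSupport (hf.continuous.comp (continuous_const_smul l))
      (hfc.comp_homeomorph (Homeomorph.smulOfNeZero l hl0.ne')) (by linarith)
  have hcn : ‖((√(m / mass f * l ^ d) : ℝ) : ℂ)‖ = √(m / mass f * l ^ d) := by
    rw [Complex.norm_real, Real.norm_of_nonneg (Real.sqrt_nonneg _)]
  refine (csInf_le (bddBelow_energySet hd hp1 hp2 m)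
    ⟨_, _, (isH1_dilate hf hfc hl0).const_mul ((√(m / mass f * l ^ d) : ℝ) : ℂ),
      integrable_const_mul_rpow hint _, ?_, rfl⟩).trans_lt ?_
  · have h1 : mass (fun x => f (l • x)) = (l ^ d)⁻¹ * mass f :=
      integral_comp_smul_pos (fun x => ‖f x‖ ^ 2) hl0
    rw [mass_const_mul, hcn, Real.sq_sqrt (by positivity), h1]
    field_simp
  · have h1 : ∫ x, ∑ i, ‖l • fderiv ℝ f (l • x) (EuclideanSpace.single i 1)‖ ^ 2 =
        l ^ 2 * ((l ^ d)⁻¹ * ∫ x, ∑ i, ‖fderiv ℝ f x (EuclideanSpace.single i 1)‖ ^ 2) := by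
      rw [← integral_comp_smul_pos
        (fun x => ∑ i, ‖fderiv ℝ f x (EuclideanSpace.single i 1)‖ ^ 2) hl0, ← integral_const_mul]
      congr 1; ext x
      simp_rw [norm_smul, mul_pow, Finset.mul_sum, Real.norm_eq_abs, sq_abs]
    rw [energy_const_mul, hcn, integral_comp_smul_pos (fun x => ‖f x‖ ^ (p + 1)) hl0, h1]
    exact dilated_energy_neg (by positivity) hl0 hl1

/-- Amplification by m₂/m₁ > 1 gives E_min(m₂) ≤ (m₂/m₁) E_min(m₁), and E_min(m₁) is negative. -/
theorem Emin_strictAnti (hd : 1 ≤ d) (hp1 : 1 < p) (hp2 : p < 1 + 4 / d) {m₁ m₂ : ℝ}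
    (hm₁ : 0 < m₁) (hm : m₁ < m₂) : Emin d p m₂ < Emin d p m₁ := by
  have hneg := Emin_neg hd hp1 hp2 hm₁
  have hr : 1 < m₂ / m₁ := by rwa [one_lt_div hm₁]
  have hne : (energySet d p m₁).Nonempty := by
    -- An empty set would have infimum 0 by convention, contradicting negativity.
    by_contra H
    rw [Set.not_nonempty_iff_eq_empty] at H
    rw [Emin, H, Real.sInf_empty] at hneg
    exact lt_irrefl _ hneg
  have h1 : Emin d p m₂ / (m₂ / m₁) ≤ Emin d p m₁ := by
    refine le_csInf hne ?_
    rintro _ ⟨v, g, hv, hint, hmv, rfl⟩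
    rw [div_le_iff₀ (by linarith), mul_comm]
    have := Emin_le_mul_energy hd hp1 hp2 hv hint (hmv ▸ hm₁) (hmv.trans_lt hm).le
    rwa [hmv] at this
  have h2 := (div_le_iff₀ (by linarith)).1 h1
  nlinarith

/-- Allows mass below m, as interpolation may lose mass. A nonnegative energy is trivially above
E_min(m) < 0; a negative one forces positive mass and only decreases when v is amplified to mass m.
-/
theorem Emin_le_energy (hd : 1 ≤ d) (hp1 : 1 < p) (hp2 : p < 1 + 4 / d)
    {v : EuclideanSpace ℝ (Fin d) → ℂ} {g : Fin d → EuclideanSpace ℝ (Fin d) → ℂ} (hv : IsH1 v g)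
    (hint : Integrable (fun x => ‖v x‖ ^ (p + 1))) {m : ℝ} (hm0 : 0 < m) (hm : mass v ≤ m) :
    Emin d p m ≤ energy p v g := by
  rcases le_or_gt 0 (energy p v g) with h | h
  · exact (Emin_neg hd hp1 hp2 hm0).le.trans h
  have hmass : 0 < mass v := by
    refine lt_of_le_of_ne (integral_nonneg fun x => by positivity) fun H => ?_
    have h1 : (fun x => ‖v x‖ ^ 2) =ᵐ[volume] 0 :=
      (integral_eq_zero_iff_of_nonneg (fun x => by positivity)
        ((memLp_two_iff_integrable_sq_norm hv.memLp.1).1 hv.memLp)).1 H.symm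
    have h2 : ∫ x, ‖v x‖ ^ (p + 1) = 0 := by
      refine integral_eq_zero_of_ae (h1.mono fun x hx => ?_)
      have : ‖v x‖ = 0 := by simpa using hx
      simp [this, show p + 1 ≠ 0 by linarith]
    have h3 : 0 ≤ energy p v g := by
      rw [energy, h2, mul_zero, sub_zero]
      exact mul_nonneg (by norm_num) (integral_nonneg fun x =>
        Finset.sum_nonneg fun i _ => by positivity)
    linarith
  have h1 := Emin_le_mul_energy hd hp1 hp2 hv hint hmass hm
  have hr : 1 ≤ m / mass v := by rwa [one_le_div hmass]
  nlinarith

end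

section

/-! ### Elementary facts on the lattice energy -/

variable {d : ℕ} {p : ℝ}

theorem latticeKin_nonneg (h : ℝ) (v : (Fin d → ℤ) → ℂ) : 0 ≤ latticeKin h v :=
  Finset.sum_nonneg fun i _ => by positivity

theorem tsum_latticeDiff_le {v : (Fin d → ℤ) → ℂ} (hv : Summable (fun x => ‖v x‖ ^ 2))
    (i : Fin d) : ∑' x, ‖latticeDiff i v x‖ ^ 2 ≤ 4 * ∑' x, ‖v x‖ ^ 2 := by
  have h1 : Summable (fun x : Fin d → ℤ => ‖v (x + Pi.single i 1)‖ ^ 2) :=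
    hv.comp_injective (add_left_injective _)
  have h2 : ∑' x : Fin d → ℤ, ‖v (x + Pi.single i 1)‖ ^ 2 = ∑' x, ‖v x‖ ^ 2 :=
    (Equiv.addRight (Pi.single i 1 : Fin d → ℤ)).tsum_eq (fun x => ‖v x‖ ^ 2)
  calc ∑' x, ‖latticeDiff i v x‖ ^ 2
      ≤ ∑' x : Fin d → ℤ, (2 * ‖v (x + Pi.single i 1)‖ ^ 2 + 2 * ‖v x‖ ^ 2) := by
        refine (summable_latticeDiff hv i).tsum_le_tsum (fun x => ?_)
          ((h1.mul_left 2).add (hv.mul_left 2))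
        have h3 : ‖latticeDiff i v x‖ ^ 2 ≤ (‖v (x + Pi.single i 1)‖ + ‖v x‖) ^ 2 := by
          gcongr; exact norm_sub_le _ _
        nlinarith [sq_nonneg (‖v (x + Pi.single i 1)‖ - ‖v x‖)]
    _ = 4 * ∑' x, ‖v x‖ ^ 2 := by
        rw [(h1.mul_left 2).tsum_add (hv.mul_left 2), tsum_mul_left, tsum_mul_left, h2]
        ring

theorem latticeMass_latticeDiff_le {h : ℝ} (hh : 0 < h) {v : (Fin d → ℤ) → ℂ}
    (hv : Summable (fun x => ‖v x‖ ^ 2)) (i : Fin d) :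
    latticeMass h (latticeDiff i v) ≤ 4 * latticeMass h v := by
  have h1 := mul_le_mul_of_nonneg_left (tsum_latticeDiff_le hv i) (pow_pos hh d).le
  simp only [latticeMass]
  linarith

theorem latticeKin_eq {h : ℝ} (hh : 0 < h) (v : (Fin d → ℤ) → ℂ) :
    latticeKin h v = ∑ i, latticeMass h (latticeDiff i v) / h ^ 2 := by
  simp_rw [latticeKin, latticeMass_eq hh]

theorem latticeKin_le {h : ℝ} (hh : 0 < h) {v : (Fin d → ℤ) → ℂ}
    (hv : Summable (fun x => ‖v x‖ ^ 2)) :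
    latticeKin h v ≤ 4 * d * latticeMass h v / h ^ 2 := by
  rw [latticeKin_eq hh]
  calc _ ≤ ∑ i : Fin d, 4 * latticeMass h v / h ^ 2 := by
        gcongr with i
        exact latticeMass_latticeDiff_le hh hv i
    _ = _ := by simp; ring

theorem latticeMass_nonneg {h : ℝ} (hh : 0 < h) (v : (Fin d → ℤ) → ℂ) : 0 ≤ latticeMass h v := by
  rw [latticeMass_eq hh]; positivity

theorem latticeMass_latticeDiff_le_latticeKin {h : ℝ} (hh : 0 < h) (v : (Fin d → ℤ) → ℂ)
    (i : Fin d) : latticeMass h (latticeDiff i v) ≤ h ^ 2 * latticeKin h v := by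
  rw [← div_le_iff₀' (by positivity), latticeKin_eq hh]
  exact Finset.single_le_sum (f := fun i => latticeMass h (latticeDiff i v) / h ^ 2)
    (fun j _ => div_nonneg (latticeMass_nonneg hh _) (by positivity)) (Finset.mem_univ i)

theorem bddBelow_latticeEnergySet (hd : 1 ≤ d) (hp1 : 1 < p) (hp2 : p < 1 + 4 / d) {h : ℝ}
    (hh : 0 < h) (m : ℝ) : BddBelow (latticeEnergySet d p m h) := by
  obtain ⟨C, hC0, hC⟩ := le_latticeEnergy hd hp1 hp2 m
  refine ⟨-C, ?_⟩
  rintro _ ⟨v, hv, hm, rfl⟩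
  have := hC h v hh hv hm.le
  linarith [latticeKin_nonneg h v]

theorem bddAbove_latticeEnergySet (hp1 : 1 < p) {h : ℝ} (hh : 0 < h) (m : ℝ) :
    BddAbove (latticeEnergySet d p m h) := by
  refine ⟨1 / 2 * (4 * d * m / h ^ 2), ?_⟩
  rintro _ ⟨v, hv, hm, rfl⟩
  rw [latticeEnergy_eq hh (by linarith) hv, ← hm]
  have h1 := latticeKin_le hh hv
  have h2 : 0 ≤ 1 / (p + 1) * (powInt (p + 1) (stepFn h v) volume).toReal :=
    mul_nonneg (one_div_nonneg.2 (by linarith)) ENNReal.toReal_nonneg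
  linarith

theorem latticeEnergySet_nonempty {h : ℝ} (hh : 0 < h) {m : ℝ} (hm : 0 ≤ m) :
    (latticeEnergySet d p m h).Nonempty := by
  have h1 : ∀ x : Fin d → ℤ, x ≠ 0 →
      ‖(Pi.single 0 ((√(m / h ^ d) : ℝ) : ℂ) : (Fin d → ℤ) → ℂ) x‖ ^ 2 = 0 := fun x hx => by
    simp [hx]
  refine ⟨_, Pi.single 0 ((√(m / h ^ d) : ℝ) : ℂ), ?_, ?_, rfl⟩
  · exact (hasSum_single 0 h1).summable
  · rw [latticeMass, tsum_eq_single 0 h1, Pi.single_eq_same, Complex.norm_real,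
      Real.norm_of_nonneg (Real.sqrt_nonneg _), Real.sq_sqrt (by positivity)]
    field_simp

theorem latticeEmin_le_latticeEmax (hd : 1 ≤ d) (hp1 : 1 < p) (hp2 : p < 1 + 4 / d) {h : ℝ}
    (hh : 0 < h) {m : ℝ} (hm : 0 ≤ m) : latticeEmin d p m h ≤ latticeEmax d p m h :=
  csInf_le_csSup (latticeEnergySet_nonempty hh hm) (bddBelow_latticeEnergySet hd hp1 hp2 hh m)
    (bddAbove_latticeEnergySet hp1 hh m)

/-! ### Lower bound for the lattice minimum energy -/

/-- For a > b, convexity bounds the chord slope by the derivative at a. -/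
theorem rpow_sub_rpow_le {a b w A q : ℝ} (ha : 0 ≤ a) (hb : 0 ≤ b) (hab : a ≤ b + w)
    (hA : a ≤ A) (hw : 0 ≤ w) (hq : 1 ≤ q) : a ^ q - b ^ q ≤ q * A ^ (q - 1) * w := by
  have hA0 := ha.trans hA
  have hqA : 0 ≤ q * A ^ (q - 1) := by positivity
  rcases le_or_gt a b with h | h
  · have h1 : a ^ q ≤ b ^ q := by gcongr
    have h2 : 0 ≤ q * A ^ (q - 1) * w := by positivity
    linarith
  · have h1 := (convexOn_rpow hq).slope_le_of_hasDerivAt (x := b) (y := a) hb ha h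
      (Real.hasDerivAt_rpow_const (Or.inr hq))
    rw [slope_def_field, div_le_iff₀ (by linarith)] at h1
    calc a ^ q - b ^ q ≤ q * a ^ (q - 1) * (a - b) := h1
      _ ≤ q * A ^ (q - 1) * w := by
        gcongr
        linarith

/-- The Gagliardo-Nirenberg bound with L = 1 is applied to the difference itself: its mass is at
most h²K, and its Dirichlet energy stays bounded by the crude estimate 4d·mass/h². The right side
therefore tends to 0 with h. -/
theorem powInt_latticeDiff_le (hd : 1 ≤ d) (hp1 : 1 < p) (hp2 : p < 1 + 4 / d) {h K : ℝ}
    (hh : 0 < h) {v : (Fin d → ℤ) → ℂ} (hv : Summable (fun x => ‖v x‖ ^ 2))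
    (hK : latticeKin h v ≤ K) (i : Fin d) :
    powInt (p + 1) (stepFn h (latticeDiff i v)) volume ≤ ENNReal.ofReal
      (h ^ 2 * K + gnConst d (p + 1) * (h ^ 2 * K) ^ (2 / d : ℝ) * (4 * d * K)) := by
  have hG := gnConst_nonneg d (p + 1)
  have h1 := powInt_stepFn_le hd (by linarith : 2 < p + 1) (by linarith) one_pos hh
    (summable_latticeDiff hv i)
  simp only [Real.one_rpow, one_mul, mul_one] at h1
  refine h1.trans (ENNReal.ofReal_le_ofReal ?_)
  have h2 : latticeMass h (latticeDiff i v) ≤ h ^ 2 * K :=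
    (latticeMass_latticeDiff_le_latticeKin hh v i).trans (by gcongr)
  have h3 : latticeKin h (latticeDiff i v) ≤ 4 * d * K := by
    refine (latticeKin_le hh (summable_latticeDiff hv i)).trans ?_
    rw [div_le_iff₀ (by positivity)]
    calc _ ≤ 4 * d * (h ^ 2 * K) := by gcongr
      _ = _ := by ring
  have h4 := latticeMass_nonneg hh (latticeDiff i v)
  have h5 := latticeKin_nonneg h (latticeDiff i v)
  have hK0 := (latticeKin_nonneg h v).trans hK
  gcongr

theorem kin_le_latticeKin {h : ℝ} (hh : 0 < h) {v : (Fin d → ℤ) → ℂ}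
    (hv : Summable (fun x => ‖v x‖ ^ 2)) {g : Fin d → EuclideanSpace ℝ (Fin d) → ℂ}
    (hg : ∀ i, powInt 2 (g i) volume ≤
      ENNReal.ofReal ((h ^ 2)⁻¹) * powInt 2 (stepFn h (latticeDiff i v)) volume) :
    kin g ≤ latticeKin h v := by
  refine Finset.sum_le_sum fun i _ => ?_
  have h1 := ENNReal.toReal_mono (ENNReal.mul_ne_top ENNReal.ofReal_ne_top
    (powInt_stepFn_two_ne_top hh (summable_latticeDiff hv i))) (hg i)
  rwa [ENNReal.toReal_mul, ENNReal.toReal_ofReal (by positivity), inv_mul_eq_div] at h1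

theorem toReal_eLpNorm_rpow {X : Type*} [MeasurableSpace X] {μ : Measure X} {q : ℝ} (hq : 0 < q)
    (f : X → ℂ) : (eLpNorm f (ENNReal.ofReal q) μ).toReal ^ q = (powInt q f μ).toReal := by
  rw [ENNReal.toReal_rpow, eLpNorm_ofReal_rpow hq]

theorem eLpNorm_le_of_powInt_le {X : Type*} [MeasurableSpace X] {μ : Measure X} {q a : ℝ}
    (hq : 0 < q) (ha : 0 ≤ a) {f : X → ℂ} (hf : powInt q f μ ≤ ENNReal.ofReal a) :
    eLpNorm f (ENNReal.ofReal q) μ ≤ ENNReal.ofReal (a ^ (1 / q)) := by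
  rw [← ENNReal.rpow_le_rpow_iff hq, eLpNorm_ofReal_rpow hq,
    ENNReal.ofReal_rpow_of_nonneg (by positivity) hq.le, ← Real.rpow_mul ha,
    one_div_mul_cancel hq.ne', Real.rpow_one]
  exact hf

/-- The error made by interpolation of a lattice function whose Dirichlet energy is at most `K`. -/
def interpError (d : ℕ) (p K h : ℝ) : ℝ :=
  d * (h ^ 2 * K + gnConst d (p + 1) * (h ^ 2 * K) ^ (2 / d : ℝ) * (4 * d * K)) ^ (1 / (p + 1))

theorem tendsto_interpError (hd : 1 ≤ d) (hp1 : 1 < p) (K : ℝ) :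
    Tendsto (interpError d p K) (𝓝[>] 0) (𝓝 0) := by
  have hd0 : (0 : ℝ) < d := by exact_mod_cast hd
  have hc : Continuous (interpError d p K) := by
    unfold interpError
    refine continuous_const.mul (Continuous.rpow_const ?_ fun x =>
      Or.inr (one_div_nonneg.2 (by linarith)))
    refine Continuous.add (by fun_prop) (Continuous.mul (continuous_const.mul ?_) continuous_const)
    exact Continuous.rpow_const (by fun_prop) fun x => Or.inr (by positivity)
  have h0 : interpError d p K 0 = 0 := by
    have h1 : (0 : ℝ) ^ (2 / d : ℝ) = 0 := Real.zero_rpow (by positivity)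
    have h2 : (0 : ℝ) ^ (1 / (p + 1) : ℝ) = 0 :=
      Real.zero_rpow (one_div_ne_zero (by linarith))
    simp [interpError, h1] 
    right
    simpa using h2
  have := hc.tendsto 0
  rw [h0] at this
  exact this.mono_left nhdsWithin_le_nhds

/-- Negative energy bounds the Dirichlet energy by K, hence the L^{p+1} norm, independently of h.
The interpolant is then admissible for `Emin_le_energy`, and only the L^{p+1} term is lossy, by at
most A times the interpolation error. -/
theorem Emin_le_latticeEnergy_add (hd : 1 ≤ d) (hp1 : 1 < p) (hp2 : p < 1 + 4 / d) {m₁ : ℝ}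
    (hm₁ : 0 < m₁) : ∃ K A : ℝ, ∀ (h : ℝ) (v : (Fin d → ℤ) → ℂ), 0 < h →
      Summable (fun x => ‖v x‖ ^ 2) → latticeMass h v ≤ m₁ → latticeEnergy p h v < 0 →
      Emin d p m₁ ≤ latticeEnergy p h v + A * interpError d p K h := by
  obtain ⟨C, hC0, hC⟩ := exists_powInt_stepFn_bound hd hp1 hp2 m₁
  obtain ⟨C', hC0', hC'⟩ := le_latticeEnergy hd hp1 hp2 m₁
  refine ⟨4 * C', ((C + C') ^ (1 / (p + 1))) ^ (p + 1 - 1), fun h v hh hv hm he => ?_⟩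
  have hp0 : 0 < p + 1 := by linarith
  have hK : latticeKin h v ≤ 4 * C' := by linarith [hC' h v hh hv hm]
  obtain ⟨hfin, hQ⟩ := hC h v hh hv hm
  obtain ⟨u, g, hu, hu1, hu2, hg⟩ := exists_interpolant hh hv
  have hkin := kin_le_latticeKin hh hv hg
  have hufin : powInt (p + 1) u volume ≠ ⊤ := ne_top_of_le_ne_top hfin (hu1 _ (by linarith))
  have hmass : mass u ≤ m₁ := by
    refine le_trans ?_ hm
    rw [mass_eq hu.memLp.1, latticeMass_eq hh]
    exact ENNReal.toReal_mono (powInt_stepFn_two_ne_top hh hv) (hu1 2 one_le_two)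
  have h1 := Emin_le_energy hd hp1 hp2 hu
    ((powInt_ne_top_iff hu.memLp.1 hp0.le).1 hufin) hm₁ hmass
  rw [hu.energy_eq hp0.le] at h1
  rw [latticeEnergy_eq hh hp0.le hv]
  set X := h ^ 2 * (4 * C') +
    gnConst d (p + 1) * (h ^ 2 * (4 * C')) ^ (2 / d : ℝ) * (4 * d * (4 * C')) with hX
  have hX0 : 0 ≤ X := by have := gnConst_nonneg d (p + 1); positivity
  have hw : interpError d p (4 * C') h = d * X ^ (1 / (p + 1)) := rfl
  have hw0 : 0 ≤ interpError d p (4 * C') h := by rw [hw]; positivity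
  have h2 : ∑ i, eLpNorm (stepFn h (latticeDiff i v)) (ENNReal.ofReal (p + 1)) volume ≤
      ENNReal.ofReal (interpError d p (4 * C') h) := by
    calc _ ≤ ∑ i : Fin d, ENNReal.ofReal (X ^ (1 / (p + 1))) := by
          gcongr with i
          exact eLpNorm_le_of_powInt_le hp0 hX0 (powInt_latticeDiff_le hd hp1 hp2 hh hv hK i)
      _ = _ := by
          rw [hw, ENNReal.ofReal_mul (by positivity)]
          simp
  set a := (eLpNorm (stepFn h v) (ENNReal.ofReal (p + 1)) volume).toReal with ha
  set b := (eLpNorm u (ENNReal.ofReal (p + 1)) volume).toReal with hb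
  have ha' : a ^ (p + 1) = (powInt (p + 1) (stepFn h v) volume).toReal := toReal_eLpNorm_rpow hp0 _
  have hb' : b ^ (p + 1) = (powInt (p + 1) u volume).toReal := toReal_eLpNorm_rpow hp0 _
  have hbfin : eLpNorm u (ENNReal.ofReal (p + 1)) volume ≠ ⊤ := fun H => by
    rw [← eLpNorm_ofReal_rpow hp0, H, ENNReal.top_rpow_of_pos hp0] at hufin
    exact hufin rfl
  have hab : a ≤ b + interpError d p (4 * C') h := by
    have h3 := (hu2 (p + 1) (by linarith)).trans (add_le_add le_rfl h2)
    have h4 := ENNReal.toReal_mono (ENNReal.add_ne_top.2 ⟨hbfin, ENNReal.ofReal_ne_top⟩) h3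
    rwa [ENNReal.toReal_add hbfin ENNReal.ofReal_ne_top, ENNReal.toReal_ofReal hw0] at h4
  have haA : a ≤ (C + C') ^ (1 / (p + 1)) := by
    have h3 : a ^ (p + 1) ≤ C + C' := by rw [ha']; linarith
    calc a = (a ^ (p + 1)) ^ (1 / (p + 1)) := by
          rw [← Real.rpow_mul ENNReal.toReal_nonneg, mul_one_div_cancel hp0.ne', Real.rpow_one]
      _ ≤ _ := by gcongr
  have h5 := rpow_sub_rpow_le ENNReal.toReal_nonneg ENNReal.toReal_nonneg hab haA hw0
    (by linarith : 1 ≤ p + 1)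
  rw [ha', hb'] at h5
  have h6 : 1 / (p + 1) * ((powInt (p + 1) (stepFn h v) volume).toReal -
      (powInt (p + 1) u volume).toReal) ≤
      ((C + C') ^ (1 / (p + 1))) ^ (p + 1 - 1) * interpError d p (4 * C') h := by
    rw [one_div_mul_eq_div, div_le_iff₀' hp0]
    linarith
  linarith

theorem eventually_le_latticeEmin (hd : 1 ≤ d) (hp1 : 1 < p) (hp2 : p < 1 + 4 / d) {m₁ : ℝ}
    (hm₁ : 0 < m₁) {ε : ℝ} (hε : 0 < ε) :
    ∀ᶠ h in 𝓝[>] (0 : ℝ), ∀ m ≤ m₁, Emin d p m₁ - ε ≤ latticeEmin d p m h := by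
  obtain ⟨K, A, hKA⟩ := Emin_le_latticeEnergy_add hd hp1 hp2 hm₁
  have hlim : Tendsto (fun h => A * interpError d p K h) (𝓝[>] 0) (𝓝 0) := by
    simpa using (tendsto_interpError hd hp1 K).const_mul A
  have hneg := Emin_neg hd hp1 hp2 hm₁
  filter_upwards [hlim.eventually (gt_mem_nhds hε), self_mem_nhdsWithin] with h h1 hh m hm
  rcases (latticeEnergySet d p m h).eq_empty_or_nonempty with h2 | h2
  -- For m < 0 no function is admissible and the infimum is 0 by convention, which exceeds the
  -- negative bound.
  · rw [latticeEmin, h2, Real.sInf_empty]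
    linarith
  · refine le_csInf h2 ?_
    rintro _ ⟨v, hv, hmv, rfl⟩
    rcases le_or_gt 0 (latticeEnergy p h v) with h3 | h3
    · linarith
    · linarith [hKA h v hh hv (hmv.trans_le hm) h3]

end

section

/-! ### Upper bound for the lattice minimum energy -/

variable {d : ℕ} {p : ℝ}

theorem latticeMass_const_mul (h : ℝ) (v : (Fin d → ℤ) → ℂ) (c : ℂ) :
    latticeMass h (fun x => c * v x) = ‖c‖ ^ 2 * latticeMass h v := by
  simp_rw [latticeMass, norm_mul, mul_pow, tsum_mul_left]
  ring

theorem latticeKin_const_mul {h : ℝ} (hh : 0 < h) (v : (Fin d → ℤ) → ℂ) (c : ℂ) :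
    latticeKin h (fun x => c * v x) = ‖c‖ ^ 2 * latticeKin h v := by
  have h1 : ∀ i, latticeDiff i (fun x => c * v x) = fun x => c * latticeDiff i v x := fun i => by
    ext x; simp [latticeDiff, mul_sub]
  simp_rw [latticeKin_eq hh, h1, latticeMass_const_mul, Finset.mul_sum, mul_div_assoc]

theorem powInt_stepFn_const_mul {h : ℝ} (hh : 0 < h) {q : ℝ} (hq : 0 ≤ q) (v : (Fin d → ℤ) → ℂ)
    (c : ℂ) : (powInt q (stepFn h (fun x => c * v x)) volume).toReal =
      ‖c‖ ^ q * (powInt q (stepFn h v) volume).toReal := by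
  simp_rw [toReal_powInt_stepFn hh hq, norm_mul,
    Real.mul_rpow (norm_nonneg _) (norm_nonneg _), tsum_mul_left]
  ring

/-- The test function is v rescaled to mass m. The two energy terms are kept apart so that the ratio
may lie on either side of 1. -/
theorem latticeEmin_le (hd : 1 ≤ d) (hp1 : 1 < p) (hp2 : p < 1 + 4 / d) {h m : ℝ} (hh : 0 < h)
    (hm : 0 ≤ m) {v : (Fin d → ℤ) → ℂ} (hv : Summable (fun x => ‖v x‖ ^ 2))
    (hv0 : 0 < latticeMass h v) :
    latticeEmin d p m h ≤ m / latticeMass h v * (1 / 2 * latticeKin h v) -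
      √(m / latticeMass h v) ^ (p + 1) *
        (1 / (p + 1) * (powInt (p + 1) (stepFn h v) volume).toReal) := by
  have hc : ‖((√(m / latticeMass h v) : ℝ) : ℂ)‖ = √(m / latticeMass h v) := by
    rw [Complex.norm_real, Real.norm_of_nonneg (Real.sqrt_nonneg _)]
  have hc2 : √(m / latticeMass h v) ^ 2 = m / latticeMass h v := Real.sq_sqrt (by positivity)
  have hs : Summable (fun x => ‖((√(m / latticeMass h v) : ℝ) : ℂ) * v x‖ ^ 2) := by
    simp_rw [norm_mul, mul_pow]
    exact hv.mul_left _
  refine (csInf_le (bddBelow_latticeEnergySet hd hp1 hp2 hh m)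
    ⟨fun x => ((√(m / latticeMass h v) : ℝ) : ℂ) * v x, hs, ?_, rfl⟩).trans_eq ?_
  · rw [latticeMass_const_mul, hc, hc2, div_mul_cancel₀ _ hv0.ne']
  · rw [latticeEnergy_eq hh (by linarith) hs, latticeKin_const_mul hh,
      powInt_stepFn_const_mul hh (by linarith), hc, hc2]
    ring

theorem tendsto_latticeMass_cellAvg {v : EuclideanSpace ℝ (Fin d) → ℂ} (hv : MemLp v 2 volume) :
    Tendsto (fun h => latticeMass h (cellAvg h v)) (𝓝[>] 0) (𝓝 (mass v)) := by
  refine tendsto_order.2 ⟨fun a ha => ?_, fun a ha => ?_⟩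
  · filter_upwards [eventually_latticeMass_cellAvg hv (half_pos (sub_pos.2 ha))] with h h1
    linarith [h1.1]
  · filter_upwards [eventually_latticeMass_cellAvg hv one_pos] with h h1
    linarith [h1.2]

/-- The cell averages of a near-minimiser of mass m₀ are rescaled to mass m₀ - h; the scaling factor
tends to 1. -/
theorem eventually_latticeEmin_le (hd : 1 ≤ d) (hp1 : 1 < p) (hp2 : p < 1 + 4 / d) {m₀ : ℝ}
    (hm₀ : 0 < m₀) {ε : ℝ} (hε : 0 < ε) :
    ∀ᶠ h in 𝓝[>] (0 : ℝ), latticeEmin d p (m₀ - h) h ≤ Emin d p m₀ + ε := by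
  have hneg := Emin_neg hd hp1 hp2 hm₀
  have hne : (energySet d p m₀).Nonempty := by
    by_contra H
    rw [Set.not_nonempty_iff_eq_empty] at H
    rw [Emin, H, Real.sInf_empty] at hneg
    exact lt_irrefl _ hneg
  obtain ⟨_, ⟨v, g, hv, hint, hm, rfl⟩, hlt⟩ := exists_lt_of_csInf_lt hne
    (lt_add_of_pos_right (sInf (energySet d p m₀)) (half_pos hε))
  have hp0 : 0 < p + 1 := by linarith
  have hfin := (powInt_ne_top_iff hv.memLp.1 hp0.le).2 hint
  rw [hv.energy_eq hp0.le] at hlt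
  set P := (powInt (p + 1) v volume).toReal
  have hid : Tendsto (fun h : ℝ => h) (𝓝[>] 0) (𝓝 0) := tendsto_nhdsWithin_of_tendsto_nhds tendsto_id
  have hM := tendsto_latticeMass_cellAvg hv.memLp
  rw [hm] at hM
  have hr : Tendsto (fun h => (m₀ - h) / latticeMass h (cellAvg h v)) (𝓝[>] 0) (𝓝 1) := by
    have := (hid.const_sub m₀).div hM hm₀.ne'
    rwa [sub_zero, div_self hm₀.ne'] at this
  have hs : Tendsto (fun h => √((m₀ - h) / latticeMass h (cellAvg h v)) ^ (p + 1))
      (𝓝[>] 0) (𝓝 1) := by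
    have := (((Real.continuous_sqrt.tendsto 1).comp hr).rpow_const (p := p + 1)
      (Or.inr hp0.le))
    rwa [Real.sqrt_one, Real.one_rpow] at this
  have hlim : Tendsto (fun h => (m₀ - h) / latticeMass h (cellAvg h v) * (1 / 2 * kin g) -
      √((m₀ - h) / latticeMass h (cellAvg h v)) ^ (p + 1) * (1 / (p + 1) * (P - ε / 4)))
      (𝓝[>] 0) (𝓝 (1 * (1 / 2 * kin g) - 1 * (1 / (p + 1) * (P - ε / 4)))) :=
    (hr.mul_const _).sub (hs.mul_const _)
  have hval : 1 * (1 / 2 * kin g) - 1 * (1 / (p + 1) * (P - ε / 4)) < Emin d p m₀ + ε := by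
    have h1 : 1 / (p + 1) * (ε / 4) ≤ 1 * (ε / 4) := by
      gcongr
      rw [div_le_one hp0]; linarith
    have h2 : Emin d p m₀ = sInf (energySet d p m₀) := rfl
    linarith
  filter_upwards [hlim.eventually (gt_mem_nhds hval), self_mem_nhdsWithin,
    hM.eventually (lt_mem_nhds hm₀), hid.eventually (gt_mem_nhds hm₀),
    eventually_powInt_cellAvg_ge hv.memLp (by linarith : 1 ≤ p + 1) hfin
      (by linarith : 0 < ε / 4)] with h h1 hh h2 h3 h4
  have h5 : 0 ≤ (m₀ - h) / latticeMass h (cellAvg h v) := div_nonneg (by linarith) h2.le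
  refine (latticeEmin_le hd hp1 hp2 hh (by linarith : 0 ≤ m₀ - h)
    (summable_cellAvg hh hv.memLp) h2).trans (le_trans ?_ h1.le)
  have h6 := hv.latticeKin_cellAvg_le (Set.mem_Ioi.1 hh)
  have h7 : 0 ≤ 1 / (p + 1) := one_div_nonneg.2 hp0.le
  gcongr

theorem tendsto_latticeEmin (hd : 1 ≤ d) (hp1 : 1 < p) (hp2 : p < 1 + 4 / d) {m₀ : ℝ}
    (hm₀ : 0 < m₀) :
    Tendsto (fun h => latticeEmin d p (m₀ - h) h) (𝓝[>] 0) (𝓝 (Emin d p m₀)) := by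
  refine tendsto_order.2 ⟨fun a ha => ?_, fun a ha => ?_⟩
  · filter_upwards [eventually_le_latticeEmin hd hp1 hp2 hm₀ (half_pos (sub_pos.2 ha)),
      self_mem_nhdsWithin] with h h1 hh
    have := h1 (m₀ - h) (by linarith [Set.mem_Ioi.1 hh])
    linarith
  · filter_upwards [eventually_latticeEmin_le hd hp1 hp2 hm₀ (half_pos (sub_pos.2 ha))] with h h1
    linarith

end

section

/-! ### Bounds on the rate function -/

variable {d : ℕ}

/-- The symbol `4 ∑ sin²(π x_i)` of the lattice Laplacian. -/
def symb (d : ℕ) (x : Fin d → ℝ) : ℝ := 4 * ∑ i, Real.sin (Real.pi * x i) ^ 2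

theorem symb_nonneg (x : Fin d → ℝ) : 0 ≤ symb d x :=
  mul_nonneg (by norm_num) (Finset.sum_nonneg fun i _ => sq_nonneg _)

theorem symb_le (x : Fin d → ℝ) : symb d x ≤ 4 * d := by
  have : ∑ i : Fin d, Real.sin (Real.pi * x i) ^ 2 ≤ ∑ i : Fin d, 1 :=
    Finset.sum_le_sum fun i _ => Real.sin_sq_le_one _
  simp only [Finset.sum_const, Finset.card_univ, Fintype.card_fin, nsmul_eq_mul, mul_one] at this
  unfold symb
  linarith

theorem continuous_symb : Continuous (symb d) := by unfold symb; fun_prop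

/-- Lebesgue measure on the unit cube. -/
def cube (d : ℕ) : Measure (Fin d → ℝ) := volume.restrict (Set.Icc 0 1)

theorem cube_eq_pi : cube d = Measure.pi fun _ => volume.restrict (Set.Icc (0 : ℝ) 1) := by
  rw [cube, ← Set.pi_univ_Icc, volume_pi, Measure.restrict_pi_pi]
  rfl

instance : IsProbabilityMeasure (volume.restrict (Set.Icc (0 : ℝ) 1)) := ⟨by simp⟩

instance : IsProbabilityMeasure (cube d) := by
  rw [cube_eq_pi]
  infer_instance

theorem measurePreserving_eval_cube (i : Fin d) :
    MeasurePreserving (fun x : Fin d → ℝ => x i) (cube d) (volume.restrict (Set.Icc (0 : ℝ) 1)) := by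
  rw [cube_eq_pi]
  exact measurePreserving_eval (fun _ : Fin d => volume.restrict (Set.Icc (0 : ℝ) 1)) i

theorem ae_sin_ne_zero : ∀ᵐ t : ℝ, Real.sin (Real.pi * t) ≠ 0 := by
  have h1 : (Set.range fun n : ℤ => (n : ℝ)).Countable := Set.countable_range _
  filter_upwards [h1.ae_notMem volume] with t ht h
  obtain ⟨n, hn⟩ := Real.sin_eq_zero_iff.1 h
  exact ht ⟨n, mul_left_cancel₀ Real.pi_ne_zero (by rw [← hn, mul_comm])⟩

theorem integrable_log_sin_sq :
    Integrable (fun t : ℝ => Real.log (4 * Real.sin (Real.pi * t) ^ 2))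
      (volume.restrict (Set.Icc (0 : ℝ) 1)) := by
  have h1 : IntervalIntegrable (fun t => Real.log (Real.sin (Real.pi * t))) volume 0 1 := by
    have := (intervalIntegrable_log_sin (a := 0) (b := Real.pi)).comp_mul_left (c := Real.pi)
    simpa [Real.pi_ne_zero] using this
  have h2 : IntegrableOn (fun t => Real.log (Real.sin (Real.pi * t))) (Set.Icc 0 1) volume :=
    (intervalIntegrable_iff_integrableOn_Icc_of_le zero_le_one).1 h1
  refine ((integrable_const (Real.log 4)).add (h2.const_mul 2)).congr ?_
  filter_upwards [ae_restrict_of_ae ae_sin_ne_zero] with t ht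
  rw [Pi.add_apply, Real.log_mul (by norm_num) (by positivity), Real.log_pow]
  norm_num

theorem integral_sin_pi_sq : ∫ t in Set.Icc (0 : ℝ) 1, Real.sin (Real.pi * t) ^ 2 = 1 / 2 := by
  rw [integral_Icc_eq_integral_Ioc, ← intervalIntegral.integral_of_le zero_le_one]
  rw [intervalIntegral.integral_comp_mul_left (fun x => Real.sin x ^ 2) Real.pi_ne_zero]
  simp [integral_sin_sq]
  field_simp

theorem integral_symb : ∫ x, symb d x ∂(cube d) = 2 * d := by
  simp only [symb]
  rw [integral_const_mul, integral_finsetSum]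
  · have : ∀ i : Fin d, ∫ x, Real.sin (Real.pi * x i) ^ 2 ∂(cube d) = 1 / 2 := fun i => by
      rw [← integral_sin_pi_sq, ← (measurePreserving_eval_cube i).map_eq,
        integral_map (measurePreserving_eval_cube i).measurable.aemeasurable
          (Continuous.aestronglyMeasurable (by fun_prop))]
    simp only [this, Finset.sum_const, Finset.card_univ, Fintype.card_fin, nsmul_eq_mul]
    ring
  · intro i _
    exact Integrable.of_bound (Continuous.aestronglyMeasurable (by fun_prop)) 1 (ae_of_all _ fun x => by
      rw [Real.norm_of_nonneg (sq_nonneg _)]; exact Real.sin_sq_le_one _)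

theorem ae_symb_pos (hd : 1 ≤ d) : ∀ᵐ x ∂(cube d), 0 < symb d x := by
  have i : Fin d := ⟨0, hd⟩
  filter_upwards [(measurePreserving_eval_cube i).quasiMeasurePreserving.ae
    (ae_restrict_of_ae ae_sin_ne_zero)] with x hx
  refine mul_pos (by norm_num) (Finset.sum_pos' (fun j _ => sq_nonneg _) ⟨i, Finset.mem_univ i, ?_⟩)
  positivity

/-- The only singularity is at zeros of the symbol, and one coordinate already bounds it: the
logarithm lies between log(4 sin²(π x_i)) and log(4d). -/
theorem integrable_log_symb (hd : 1 ≤ d) : Integrable (fun x => Real.log (symb d x)) (cube d) := by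
  have i : Fin d := ⟨0, hd⟩
  have h1 : Integrable (fun x : Fin d → ℝ => Real.log (4 * Real.sin (Real.pi * x i) ^ 2)) (cube d) :=
    (measurePreserving_eval_cube i).integrable_comp_of_integrable integrable_log_sin_sq
  refine (h1.abs.add (integrable_const (Real.log (4 * d)))).mono'
    (Real.measurable_log.comp continuous_symb.measurable).aestronglyMeasurable ?_
  have hd' : (1 : ℝ) ≤ d := by exact_mod_cast hd
  filter_upwards [(measurePreserving_eval_cube i).quasiMeasurePreserving.ae
    (ae_restrict_of_ae ae_sin_ne_zero), ae_symb_pos hd] with x hx hx'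
  have h2 : Real.log (4 * Real.sin (Real.pi * x i) ^ 2) ≤ Real.log (symb d x) := by
    refine Real.log_le_log (by positivity) (mul_le_mul_of_nonneg_left ?_ (by norm_num))
    exact Finset.single_le_sum (f := fun i => Real.sin (Real.pi * x i) ^ 2)
      (fun j _ => sq_nonneg _) (Finset.mem_univ i)
  have h3 : Real.log (symb d x) ≤ Real.log (4 * d) := Real.log_le_log hx' (symb_le x)
  have h4 : 0 ≤ Real.log (4 * d) := Real.log_nonneg (by linarith)
  rw [Real.norm_eq_abs, abs_le, Pi.add_apply]
  constructor
  · linarith [neg_abs_le (Real.log (4 * Real.sin (Real.pi * x i) ^ 2))]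
  · linarith [abs_nonneg (Real.log (4 * Real.sin (Real.pi * x i) ^ 2))]

/-- The constant `∫ log (4 ∑ sin²(π x_i)) dx`. -/
def rateConst (d : ℕ) : ℝ := ∫ x, Real.log (symb d x) ∂(cube d)

/-- Jensen's inequality through log t ≤ t - 1: the symbol has mean 2d. -/
theorem rateConst_le (hd : 1 ≤ d) : rateConst d ≤ Real.log (2 * d) := by
  have hd' : (1 : ℝ) ≤ d := by exact_mod_cast hd
  have hint : Integrable (symb d) (cube d) :=
    Integrable.of_bound continuous_symb.aestronglyMeasurable (4 * d) (ae_of_all _ fun x => by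
      rw [Real.norm_of_nonneg (symb_nonneg x)]; exact symb_le x)
  calc rateConst d ≤ ∫ x, (symb d x / (2 * d) + (Real.log (2 * d) - 1)) ∂(cube d) := by
        refine integral_mono_ae (integrable_log_symb hd)
          ((hint.div_const _).add (integrable_const _)) ?_
        filter_upwards [ae_symb_pos hd] with x hx
        have h1 := Real.log_le_sub_one_of_pos (x := symb d x / (2 * d)) (by positivity)
        rw [Real.log_div hx.ne' (by positivity)] at h1
        linarith
    _ = Real.log (2 * d) := by
        rw [integral_add (hint.div_const _) (integrable_const _), integral_div, integral_symb,
          div_self (by positivity)]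
        simp

theorem integrable_log_affine {a b : ℝ} (ha : 0 < a) (hb : 0 ≤ b) :
    Integrable (fun x => Real.log (a + b * symb d x)) (cube d) := by
  have hc : Continuous (fun x => Real.log (a + b * symb d x)) :=
    Continuous.log (continuous_const.add (continuous_const.mul continuous_symb)) fun x => by
      have := mul_nonneg hb (symb_nonneg x)
      positivity
  exact hc.continuousOn.integrableOn_compact isCompact_Icc

/-! ### Two-sided bounds on Ψ_d. -/

theorem PsiAux_eq (α : ℝ) : PsiAux d α = ⨆ γ ∈ Set.Ioo (0 : ℝ) 1,
    ((∫ x, Real.log (1 - γ + γ / α * symb d x) ∂(cube d) : ℝ) : EReal) := by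
  unfold PsiAux symb cube
  congr! 8 with γ _ x
  ring

/-- The integrand is at least log(1 - γ), and γ → 0. -/
theorem PsiAux_nonneg {α : ℝ} (hα : 0 < α) : 0 ≤ PsiAux d α := by
  have h0 : Tendsto (fun γ : ℝ => ((Real.log (1 - γ) : ℝ) : EReal)) (𝓝[>] 0) (𝓝 ((0 : ℝ) : EReal)) := by
    refine (continuous_coe_real_ereal.tendsto _).comp ?_
    have h1 : ContinuousAt (fun γ : ℝ => Real.log (1 - γ)) 0 :=
      (continuousAt_const.sub continuousAt_id).log (by simp)
    have h2 := h1.tendsto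
    simp only [sub_zero, Real.log_one] at h2
    exact h2.mono_left nhdsWithin_le_nhds
  rw [EReal.coe_zero] at h0
  refine le_of_tendsto h0 ?_
  filter_upwards [Ioo_mem_nhdsGT (zero_lt_one' ℝ)] with γ hγ
  rw [PsiAux_eq]
  refine le_iSup₂_of_le γ hγ (EReal.coe_le_coe_iff.2 ?_)
  have h1 : ∫ _ : Fin d → ℝ, Real.log (1 - γ) ∂(cube d) = Real.log (1 - γ) := by simp
  rw [← h1]
  refine integral_mono (integrable_const _)
    (integrable_log_affine (by linarith [hγ.2]) (div_nonneg hγ.1.le hα.le)) fun x => ?_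
  have := mul_nonneg (div_nonneg hγ.1.le hα.le) (symb_nonneg x)
  exact Real.log_le_log (by linarith [hγ.2]) (by linarith)

/-- Discard 1 - γ inside the logarithm and let γ → 1. -/
theorem le_PsiAux (hd : 1 ≤ d) {α : ℝ} (hα : 0 < α) :
    ((rateConst d - Real.log α : ℝ) : EReal) ≤ PsiAux d α := by
  have h0 : Tendsto (fun γ : ℝ => ((Real.log (γ / α) + rateConst d : ℝ) : EReal)) (𝓝[<] 1)
      (𝓝 ((rateConst d - Real.log α : ℝ) : EReal)) := by
    refine (continuous_coe_real_ereal.tendsto _).comp ?_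
    have h1 : ContinuousAt (fun γ : ℝ => Real.log (γ / α) + rateConst d) 1 :=
      ((continuousAt_id.div_const α).log (by simpa using hα.ne')).add continuousAt_const
    have h2 := h1.tendsto
    rw [Real.log_div one_ne_zero hα.ne', Real.log_one, zero_sub, neg_add_eq_sub] at h2
    exact h2.mono_left nhdsWithin_le_nhds
  refine le_of_tendsto h0 ?_
  filter_upwards [Ioo_mem_nhdsLT (zero_lt_one' ℝ)] with γ hγ
  rw [PsiAux_eq]
  refine le_iSup₂_of_le γ hγ (EReal.coe_le_coe_iff.2 ?_)
  have hγα : 0 < γ / α := div_pos hγ.1 hα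
  have h1 : Real.log (γ / α) + rateConst d =
      ∫ x, (Real.log (γ / α) + Real.log (symb d x)) ∂(cube d) := by
    rw [integral_add (integrable_const _) (integrable_log_symb hd)]
    simp [rateConst]
  rw [h1]
  refine integral_mono_ae ((integrable_const _).add (integrable_log_symb hd))
    (integrable_log_affine (by linarith [hγ.2]) hγα.le) ?_
  filter_upwards [ae_symb_pos hd] with x hx
  rw [← Real.log_mul hγα.ne' hx.ne']
  exact Real.log_le_log (by positivity) (by linarith [hγ.2])

/-- For every γ in (0,1) the argument of the logarithm is at most 1 + symb/α = (α + symb)/α.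
Dominated convergence as α → 0 makes this match the lower bound. -/
theorem PsiAux_le {α : ℝ} (hα : 0 < α) :
    PsiAux d α ≤ ((∫ x, Real.log (α + symb d x) ∂(cube d) - Real.log α : ℝ) : EReal) := by
  rw [PsiAux_eq]
  refine iSup₂_le fun γ hγ => EReal.coe_le_coe_iff.2 ?_
  have hint : Integrable (fun x => Real.log (α + symb d x)) (cube d) := by
    simpa using integrable_log_affine (d := d) hα zero_le_one
  have h1 : ∫ x, Real.log (α + symb d x) ∂(cube d) - Real.log α =
      ∫ x, (Real.log (α + symb d x) - Real.log α) ∂(cube d) := by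
    rw [integral_sub hint (integrable_const _)]
    simp
  rw [h1]
  refine integral_mono (integrable_log_affine (by linarith [hγ.2]) (div_nonneg hγ.1.le hα.le))
    (hint.sub (integrable_const _)) fun x => ?_
  have hs := symb_nonneg x
  dsimp only
  rw [← Real.log_div (by positivity) hα.ne']
  have h2 : 0 ≤ γ / α * symb d x := mul_nonneg (div_nonneg hγ.1.le hα.le) hs
  refine Real.log_le_log (by linarith [hγ.2]) ?_
  rw [add_div, div_self hα.ne']
  have h3 : γ / α * symb d x ≤ 1 / α * symb d x := by
    gcongr
    exact hγ.2.le
  rw [one_div_mul_eq_div] at h3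
  linarith [hγ.1]

theorem tendsto_integral_log_add_symb (hd : 1 ≤ d) :
    Tendsto (fun α => ∫ x, Real.log (α + symb d x) ∂(cube d)) (𝓝[>] 0) (𝓝 (rateConst d)) := by
  refine tendsto_integral_filter_of_dominated_convergence
    (fun x => |Real.log (symb d x)| + Real.log (1 + 4 * d)) ?_ ?_
    ((integrable_log_symb hd).abs.add (integrable_const _)) ?_
  · exact Eventually.of_forall fun α => (Real.measurable_log.comp
      (measurable_const.add continuous_symb.measurable)).aestronglyMeasurable
  · filter_upwards [Ioo_mem_nhdsGT (zero_lt_one' ℝ)] with α hα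
    filter_upwards [ae_symb_pos hd] with x hx
    have h1 : Real.log (symb d x) ≤ Real.log (α + symb d x) :=
      Real.log_le_log hx (by linarith [hα.1])
    have h2 : Real.log (α + symb d x) ≤ Real.log (1 + 4 * d) :=
      Real.log_le_log (by linarith [hα.1]) (by linarith [hα.2, symb_le x])
    have h3 : 0 ≤ Real.log (1 + 4 * d) := Real.log_nonneg (by
      have : (0 : ℝ) ≤ d := Nat.cast_nonneg d
      linarith)
    rw [Real.norm_eq_abs, abs_le]
    constructor
    · linarith [neg_abs_le (Real.log (symb d x))]
    · linarith [abs_nonneg (Real.log (symb d x))]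
  · filter_upwards [ae_symb_pos hd] with x hx
    have h1 : ContinuousAt (fun α : ℝ => Real.log (α + symb d x)) 0 :=
      (continuousAt_id.add continuousAt_const).log (by simpa using hx.ne')
    have h2 := h1.tendsto
    rw [zero_add] at h2
    exact h2.mono_left nhdsWithin_le_nhds

theorem le_Psi (hd : 1 ≤ d) {α : ℝ} (hα : 0 < α) :
    ((rateConst d - Real.log α : ℝ) : EReal) ≤ Psi d α := by
  have hd' : (1 : ℝ) ≤ d := by exact_mod_cast hd
  unfold Psi
  split_ifs with h1 h2 h3
  · exact le_top
  · exact le_PsiAux hd hα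
  -- From α = 2d on, the lower bound is at most 0 because c ≤ log(2d), so nonnegativity of Ψ
  -- suffices.
  · subst h3
    exact_mod_cast sub_nonpos.2 (rateConst_le hd)
  · push Not at h1 h2
    have h4 : rateConst d - Real.log α ≤ 0 := by
      have := Real.log_le_log (by positivity) h2
      linarith [rateConst_le hd]
    exact (EReal.coe_le_coe_iff.2 h4).trans (by
      simpa using PsiAux_nonneg (d := d) (by linarith [h1.2] : 0 < 4 * (d : ℝ) - α))

theorem eventually_Psi_le (hd : 1 ≤ d) {ε : ℝ} (hε : 0 < ε) :
    ∀ᶠ α in 𝓝[>] (0 : ℝ), Psi d α ≤ ((rateConst d - Real.log α + ε : ℝ) : EReal) := by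
  have hd' : (1 : ℝ) ≤ d := by exact_mod_cast hd
  filter_upwards [(tendsto_integral_log_add_symb hd).eventually
    (gt_mem_nhds (lt_add_of_pos_right _ hε)), Ioo_mem_nhdsGT (zero_lt_one' ℝ)] with α h1 hα
  unfold Psi
  rw [if_neg (by push Not; exact ⟨hα.1, by linarith [hα.2]⟩), if_pos (by linarith [hα.2])]
  refine (PsiAux_le hα.1).trans (EReal.coe_le_coe_iff.2 ?_)
  linarith

end

section

/-! ### Bounds on the functional and proof of the theorem -/

variable {d : ℕ} {p : ℝ}

theorem log_two_mul_sq {E m h : ℝ} (hE : 0 < E) (hm : 0 < m) (hh : 0 < h) :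
    Real.log m + Real.log (2 * h ^ 2 * E / m) = Real.log (2 * h ^ 2) + Real.log E := by
  rw [← Real.log_mul hm.ne' (by positivity), ← Real.log_mul (by positivity) hE.ne']
  congr 1
  field_simp

/-- The log m in Θ cancels against the mass in log(2h²E/m): the bound depends on E and h only. -/
theorem Theta_le (hd : 1 ≤ d) {E m h : ℝ} (hE : 0 < E) (hm : 0 < m) (hh : 0 < h) :
    Theta d E m h ≤ ((Real.log (2 * h ^ 2) + Real.log E - rateConst d : ℝ) : EReal) := by
  rw [Theta, if_neg hm.ne', ← log_two_mul_sq hE hm hh]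
  refine (EReal.sub_le_sub le_rfl (le_Psi hd (by positivity : 0 < 2 * h ^ 2 * E / m))).trans_eq ?_
  rw [← EReal.coe_sub]
  congr 1; ring

theorem le_Theta {E m h ε : ℝ} (hE : 0 < E) (hm : 0 < m) (hh : 0 < h)
    (hPsi : Psi d (2 * h ^ 2 * E / m) ≤
      ((rateConst d - Real.log (2 * h ^ 2 * E / m) + ε : ℝ) : EReal)) :
    ((Real.log (2 * h ^ 2) + Real.log E - rateConst d - ε : ℝ) : EReal) ≤ Theta d E m h := by
  rw [Theta, if_neg hm.ne', ← log_two_mul_sq hE hm hh]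
  refine le_trans (le_of_eq ?_) (EReal.sub_le_sub le_rfl hPsi)
  rw [← EReal.coe_sub]
  congr 1; ring

theorem Theta_eq_bot {E m h : ℝ} (hE : E ≤ 0) (hm : 0 ≤ m) : Theta d E m h = ⊥ := by
  unfold Theta
  split_ifs with h1
  · rfl
  · have h2 : 2 * h ^ 2 * E / m ≤ 0 :=
      div_nonpos_of_nonpos_of_nonneg (mul_nonpos_of_nonneg_of_nonpos (by positivity) hE) hm
    rw [Psi, if_pos (Or.inl h2)]
    rfl

theorem mul_exp_le_of_mem_maximizers (hd : 1 ≤ d) {E₀ m₀ h E m F m' ε : ℝ} (hh : 0 < h)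
    (hmax : (E, m) ∈ maximizers d p E₀ m₀ h) (hF : 0 < F) (hm' : 0 < m')
    (hreg : (F, m') ∈ region d p E₀ m₀ h)
    (hPsi : Psi d (2 * h ^ 2 * F / m') ≤
      ((rateConst d - Real.log (2 * h ^ 2 * F / m') + ε : ℝ) : EReal)) :
    F * Real.exp (-ε) ≤ E := by
  have h1 := (le_Theta hF hm' hh hPsi).trans (hmax.2 _ hreg)
  dsimp only at h1
  have hm0 : 0 ≤ m := hmax.1.1
  -- A finite lower bound on Θ excludes m = 0 and E ≤ 0, where Θ = -∞.
  have hm : 0 < m := by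
    refine lt_of_le_of_ne hm0 fun H => ?_
    rw [Theta, if_pos H.symm] at h1
    exact (EReal.bot_lt_coe _).not_ge h1
  have hE : 0 < E := by
    by_contra H
    rw [Theta_eq_bot (not_lt.1 H) hm0] at h1
    exact (EReal.bot_lt_coe _).not_ge h1
  have h2 := EReal.coe_le_coe_iff.1 (h1.trans (Theta_le hd hE hm hh))
  rw [← Real.log_le_log_iff (by positivity) hE, Real.log_mul hF.ne' (Real.exp_ne_zero _),
    Real.log_exp]
  linarith

/-- The competitor has mass h and the largest energy allowed at that mass. Its argument α = 2hF
tends to 0, so the bound on Ψ is nearly sharp, while its mass also tends to 0, so F tends to E₀ -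
E_min(m₀). Any mass between the scales h² and 1 would serve. -/
theorem eventually_mul_exp_le (hd : 1 ≤ d) (hp1 : 1 < p) (hp2 : p < 1 + 4 / (d : ℝ))
    {m₀ E₀ : ℝ} (hm₀ : 0 < m₀) (hE₀ : Emin d p m₀ < E₀) {E m : ℝ → ℝ}
    (hmax : ∀ᶠ h in 𝓝[>] (0 : ℝ), (E h, m h) ∈ maximizers d p E₀ m₀ h) {ε : ℝ} (hε : 0 < ε) :
    ∀ᶠ h in 𝓝[>] (0 : ℝ), (E₀ - latticeEmin d p (m₀ - h) h) * Real.exp (-ε) ≤ E h := by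
  have hF := (tendsto_latticeEmin hd hp1 hp2 hm₀).const_sub E₀
  have hid : Tendsto (fun h : ℝ => h) (𝓝[>] 0) (𝓝 0) :=
    tendsto_nhdsWithin_of_tendsto_nhds tendsto_id
  have hFpos := hF.eventually (lt_mem_nhds (sub_pos.2 hE₀))
  have hα : Tendsto (fun h => 2 * h ^ 2 * (E₀ - latticeEmin d p (m₀ - h) h) / h)
      (𝓝[>] 0) (𝓝[>] 0) := by
    refine tendsto_nhdsWithin_iff.2 ⟨?_, ?_⟩
    · have h1 := (hid.const_mul 2).mul hF
      rw [mul_zero, zero_mul] at h1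
      refine h1.congr' ?_
      filter_upwards [self_mem_nhdsWithin] with h hh
      have : h ≠ 0 := (Set.mem_Ioi.1 hh).ne'
      field_simp
    · filter_upwards [self_mem_nhdsWithin, hFpos] with h hh h1
      have : 0 < h := hh
      exact Set.mem_Ioi.2 (by positivity)
  filter_upwards [hmax, hFpos, hα.eventually (eventually_Psi_le hd hε), self_mem_nhdsWithin,
    hid.eventually (gt_mem_nhds hm₀)] with h h1 h2 h3 hh h4
  have hh0 : 0 < h := hh
  refine mul_exp_le_of_mem_maximizers hd hh0 h1 h2 hh0 ⟨hh0.le, h4.le, ?_, le_rfl⟩ h3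
  refine max_le (sub_le_sub_left ?_ _) h2.le
  exact latticeEmin_le_latticeEmax hd hp1 hp2 hh0 (by simpa using h4.le)

end

end NLS

end

/-! ### Convergence of the maximising energy and mass. -/

theorem mainTheorem8 (d : ℕ) (hd : 1 ≤ d) (p : ℝ) (hp1 : 1 < p) (hp2 : p < 1 + 4 / (d : ℝ))
    (m₀ E₀ : ℝ) (hm₀ : 0 < m₀) (hE₀ : NLS.Emin d p m₀ < E₀)
    (E m : ℝ → ℝ)
    (hmax : ∀ᶠ h in 𝓝[>] (0 : ℝ), (E h, m h) ∈ NLS.maximizers d p E₀ m₀ h) :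
    Tendsto m (𝓝[>] 0) (𝓝 0) ∧
      Tendsto E (𝓝[>] 0) (𝓝 (E₀ - NLS.Emin d p m₀)) := by
  have hF := (NLS.tendsto_latticeEmin hd hp1 hp2 hm₀).const_sub E₀
  have hlow : ∀ a < E₀ - NLS.Emin d p m₀, ∀ᶠ h in 𝓝[>] (0 : ℝ), a < E h := by
    intro a ha
    have h1 : Tendsto (fun ε : ℝ => (E₀ - NLS.Emin d p m₀) * Real.exp (-ε)) (𝓝[>] 0)
        (𝓝 ((E₀ - NLS.Emin d p m₀) * Real.exp (-0))) :=
      ((continuous_const.mul (Real.continuous_exp.comp continuous_neg)).tendsto 0).mono_left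
        nhdsWithin_le_nhds
    rw [neg_zero, Real.exp_zero, mul_one] at h1
    -- ε is fixed before h → 0, so small that the factor e^{-ε} keeps the limit above a.
    obtain ⟨ε, h2, hε⟩ := ((h1.eventually (lt_mem_nhds ha)).and self_mem_nhdsWithin).exists
    filter_upwards [(hF.mul_const (Real.exp (-ε))).eventually (lt_mem_nhds h2),
      NLS.eventually_mul_exp_le hd hp1 hp2 hm₀ hE₀ hmax hε] with h h3 h4
    exact h3.trans_le h4
  -- Used with m₁ = m₀ for the upper bound on the energy, and with m₁ < m₀ to exclude a persistent
  -- mass.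
  have hup : ∀ m₁ : ℝ, 0 < m₁ → ∀ ε : ℝ, 0 < ε → ∀ᶠ h in 𝓝[>] (0 : ℝ), m₀ - m h ≤ m₁ →
      E h ≤ E₀ - NLS.Emin d p m₁ + ε := by
    intro m₁ hm₁ ε hε
    filter_upwards [hmax, NLS.eventually_le_latticeEmin hd hp1 hp2 hm₁ hε] with h h1 h2 h3
    have h4 : E h ≤ E₀ - NLS.latticeEmin d p (m₀ - m h) h := h1.1.2.2.2
    linarith [h2 _ h3]
  refine ⟨tendsto_order.2 ⟨fun a ha => ?_, fun a ha => ?_⟩,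
    tendsto_order.2 ⟨hlow, fun a ha => ?_⟩⟩
  · filter_upwards [hmax] with h h1
    exact ha.trans_le h1.1.1
  -- The cap at m₀/2 keeps m₀ - η positive, as strict monotonicity requires. Both bounds on E_h use
  -- half of the gap between E_min(m₀ - η) and E_min(m₀), which makes them incompatible when m_h ≥
  -- a.
  · have hη : 0 < min a (m₀ / 2) := lt_min ha (half_pos hm₀)
    have hη' : 0 < m₀ - min a (m₀ / 2) := by linarith [min_le_right a (m₀ / 2)]
    have hgap := NLS.Emin_strictAnti hd hp1 hp2 hη' (by linarith : m₀ - min a (m₀ / 2) < m₀)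
    filter_upwards [hup _ hη' _ (half_pos (sub_pos.2 hgap)),
      hlow _ (sub_lt_self _ (half_pos (sub_pos.2 hgap)))] with h h1 h2
    by_contra h3
    have h4 := h1 (by linarith [min_le_left a (m₀ / 2)])
    linarith
  · filter_upwards [hmax, hup m₀ hm₀ _ (half_pos (sub_pos.2 ha))] with h h1 h2
    have h3 : 0 ≤ m h := h1.1.1
    linarith [h2 (by linarith)]
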